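/- **Proposition (Wiman arrangement).** An arrangement of lines is a finite set of lines in $\mathbb{P}^2_{\mathbb{C}}$. For an arrangement $\mathcal{A}$ let $t_r$ be the number of points where exactly $r$ of its lines meet. The arrangement $\mathcal{A}$ is *supersolvable* if its intersection lattice $L(\mathcal{A})$ has a maximal chain of modular elements. A *supersolvable resolution of length $k$* of $\mathcal{A}$ is a chain of arrangements $\mathcal{A}=Y_0\subseteq Y_1\subseteq\dots\subseteq Y_k$ with $|Y_i|=|\mathcal{A}|+i$ for $0\le i\le k$ and $Y_k$ supersolvable, and $\operatorname{ext\,SS}(\mathcal{A})$ is the least length of such a resolution. The arrangement $\mathcal{A}$ is *free with exponents* $(d_2,d_3)$ if the module $D(\mathcal{A})=\{\theta\in\operatorname{Der}_{\mathbb{C}}(\mathbb{C}[x,y,z]) : \theta(\alpha_\ell)\in\langle\alpha_\ell\rangle \text{ for all } \ell\in\mathcal{A}\}$, where $\alpha_\ell$ is a linear form defining $\ell$, has a basis of homogeneous derivations of degrees $1,d_2,d_3$. Let $\mathcal{W}$ be the Wiman arrangement, that is, the set of axes of the involutions of the Valentiner group $G\subset \mathrm{GL}_3(\mathbb{C})$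 (of order $1080$); with $\omega=\frac{-1+\sqrt{-3}}{2}$, $\mu_1=\frac{-1+\sqrt5}{2}$, $\mu_2=\frac{-1-\sqrt5}{2}$, the group $G$ is generated by $$\begin{pmatrix}0&1&0\\0&0&1\\1&0&0\end{pmatrix},\quad \begin{pmatrix}1&0&0\\0&-1&0\\0&0&-1\end{pmatrix},\quad \frac12\begin{pmatrix}-1&\mu_2&\mu_1\\ \mu_2&\mu_1&-1\\ \mu_1&-1&\mu_2\end{pmatrix},\quad \begin{pmatrix}-1&0&0\\0&0&-\omega^2\\0&-\omega&0\end{pmatrix},$$ and $\mathcal{W}$ is the $G$-orbit of the line $x=0$. Then $\mathcal{W}$ consists of $45$ lines, with $t_3=120$, $t_4=45$, $t_5=36$, and $$\operatorname{ext\,SS}(\mathcal{W})\le 125 .$$ Moreover, let $O$ be any quintuple point of $\mathcal{W}$. Exactly $125$ singular points of $\mathcal{W}$ lie on none of the five lines of $\mathcal{W}$ through $O$. Let $\mathcal{J}$ be the set of lines that join $O$ to these $125$ points. Then: 1. $\mathcal{J}$ consists of $85$ distinct lines, and $\mathcal{W}\cup\mathcal{J}$ is a supersolvable arrangement of $130$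 lines, free with exponents $(40,89)$. 2. There is a supersolvable resolution $\mathcal{W}=Y_0\subseteq\dots\subseteq Y_{125}$ of length $125$ such that $\mathcal{J}\subseteq Y_{125}$ and every line of $Y_{125}\setminus\mathcal{W}$ passes through $O$. The supersolvable arrangement $Y_{125}$ has $170$ lines and is free with exponents $(40,129)$. -/

import Mathlib

open scoped LinearAlgebra.Projectivization Matrix MatrixGroups

noncomputable section

namespace LineArr

/-- Points of the complex projective plane. -/
abbrev Point : Type := ℙ ℂ (Fin 3 → ℂ)

/-- Lines of the complex projective plane, given by their coefficients: the line `[a : b : c]` is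
the set of points `(x : y : z)` with `a x + b y + c z = 0`. Incidence `P ∈ l` is Mathlib's
`Configuration.ofField` membership, that is, the vanishing of the dot product. -/
abbrev Line : Type := ℙ ℂ (Fin 3 → ℂ)

/-- The set of points of a line. -/
def Line.pts (l : Line) : Set Point := {P | P ∈ l}

/-! ### Numerical data of an arrangement of lines

An arrangement of lines is a finite set of lines. -/

/-- The number of lines of `A` through the point `P`. -/
def mult (A : Set Line) (P : Point) : ℕ := {l ∈ A | P ∈ l}.ncard

/-- The number `t_r` of `r`-fold points: points where exactly `r` lines of `A` meet. -/
def t (A : Set Line) (r : ℕ) : ℕ := {P : Point | mult A P = r}.ncard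

/-- The singular points of `A`: the points that lie on at least two lines of `A`. -/
def Sing (A : Set Line) : Set Point := {P | ∃ l ∈ A, ∃ m ∈ A, l ≠ m ∧ P ∈ l ∧ P ∈ m}

/-! ### The intersection lattice and supersolvability -/

/-- The intersection lattice `L(A)`: all intersections of subfamilies of `A` (the empty
intersection is the whole plane, and the empty set occurs when the lines of `A` have no common
point). -/
def IntersectionLattice (A : Set Line) : Type :=
  {X : Set Point // ∃ B ⊆ A, X = ⋂ l ∈ B, Line.pts l}

namespace IntersectionLattice

variable {A : Set Line}

/-- The order of `L(A)` is reverse inclusion; the join is the intersection, and the meet is the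
intersection of all lines of `A` that contain both flats. -/
instance : Lattice (IntersectionLattice A) where
  le X Y := Y.1 ⊆ X.1
  le_refl X := subset_rfl
  le_trans X Y Z hXY hYZ := hYZ.trans hXY
  le_antisymm X Y hXY hYX := Subtype.ext (Set.Subset.antisymm hYX hXY)
  sup X Y := ⟨X.1 ∩ Y.1, by
    obtain ⟨B, hB, hX⟩ := X.2
    obtain ⟨C, hC, hY⟩ := Y.2
    exact ⟨B ∪ C, Set.union_subset hB hC, by rw [hX, hY, Set.biInter_union]⟩⟩
  le_sup_left X Y := Set.inter_subset_left
  le_sup_right X Y := Set.inter_subset_right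
  sup_le X Y Z hX hY := Set.subset_inter hX hY
  inf X Y := ⟨⋂ l ∈ {l ∈ A | X.1 ⊆ Line.pts l ∧ Y.1 ⊆ Line.pts l}, Line.pts l,
    _, fun _ h => h.1, rfl⟩
  inf_le_left X Y := Set.subset_iInter₂ fun _ h => h.2.1
  inf_le_right X Y := Set.subset_iInter₂ fun _ h => h.2.2
  le_inf X Y Z hXY hXZ := by
    obtain ⟨B, hB, hX⟩ := X.2
    change (⋂ l ∈ {l ∈ A | Y.1 ⊆ Line.pts l ∧ Z.1 ⊆ Line.pts l}, Line.pts l) ⊆ X.1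
    rw [hX]
    refine Set.subset_iInter₂ fun l hl => Set.biInter_subset_of_mem ⟨hB hl, ?_, ?_⟩
    · exact Set.Subset.trans hXY (by rw [hX]; exact Set.biInter_subset_of_mem hl)
    · exact Set.Subset.trans hXZ (by rw [hX]; exact Set.biInter_subset_of_mem hl)

end IntersectionLattice

/-- `x` is a modular element: `(x, y)` is a modular pair for every `y`. -/
def IsModularElement {L : Type*} [Lattice L] (x : L) : Prop :=
  ∀ y z : L, z ≤ y → z ⊔ (x ⊓ y) = (z ⊔ x) ⊓ y

/-- Supersolvability of an intersection lattice: there is a maximal chain of modular elements. -/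
def IsSupersolvableLattice (L : Type*) [Lattice L] : Prop :=
  ∃ c : Set L, IsMaxChain (· ≤ ·) c ∧ ∀ x ∈ c, IsModularElement x

/-- An arrangement is supersolvable if its intersection lattice is. -/
def IsSupersolvable (A : Set Line) : Prop := IsSupersolvableLattice (IntersectionLattice A)

/-- A supersolvable resolution `A = Y 0 ⊆ Y 1 ⊆ ... ⊆ Y k` of length `k`: finite arrangements with
`|Y i| = |A| + i`, the last of them supersolvable. -/
def IsSupersolvableResolution (A : Set Line) (k : ℕ) (Y : Fin (k + 1) → Set Line) : Prop :=
  Y 0 = A ∧ Monotone Y ∧ (∀ i, (Y i).Finite ∧ (Y i).ncard = A.ncard + i) ∧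
    IsSupersolvable (Y (Fin.last k))

/-- The extension to supersolvability number: the least length of a supersolvable resolution
(`⊤` if there is none). -/
def extSS (A : Set Line) : ℕ∞ :=
  ⨅ (k : ℕ) (_ : ∃ Y : Fin (k + 1) → Set Line, IsSupersolvableResolution A k Y), (k : ℕ∞)

/-! ### Logarithmic derivations and exponents -/

/-- A linear form defining the line `l` (unique up to a nonzero scalar). -/
def Line.form (l : Line) : MvPolynomial (Fin 3) ℂ :=
  ∑ i, MvPolynomial.C (l.rep i) * MvPolynomial.X i

/-- The module `D(A)` of derivations `θ` of `ℂ[x, y, z]` such that `θ(α_l) ∈ ⟨α_l⟩` for all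
`l ∈ A`. -/
def logDer (A : Set Line) : Submodule (MvPolynomial (Fin 3) ℂ)
    (Derivation ℂ (MvPolynomial (Fin 3) ℂ) (MvPolynomial (Fin 3) ℂ)) where
  carrier := {θ | ∀ l ∈ A, θ (Line.form l) ∈ Ideal.span {Line.form l}}
  add_mem' h₁ h₂ l hl := by
    rw [Derivation.add_apply]
    exact Ideal.add_mem _ (h₁ l hl) (h₂ l hl)
  zero_mem' l _ := by
    rw [Derivation.zero_apply]
    exact Ideal.zero_mem _
  smul_mem' f _ h l hl := by
    rw [Derivation.smul_apply, smul_eq_mul]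
    exact Ideal.mul_mem_left _ f (h l hl)

/-- `A` is free with exponents `(d₂, d₃)`: the module `D(A)` has a basis of homogeneous derivations
of degrees `1, d₂, d₃`. -/
def IsFreeWithExponents (A : Set Line) (d₂ d₃ : ℕ) : Prop :=
  ∃ b : Module.Basis (Fin 3) (MvPolynomial (Fin 3) ℂ) (logDer A),
    ∀ i j, MvPolynomial.IsHomogeneous
      ((b i : Derivation ℂ (MvPolynomial (Fin 3) ℂ) (MvPolynomial (Fin 3) ℂ))
        (MvPolynomial.X j)) (![1, d₂, d₃] i)

/-! ### The Wiman arrangement -/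

/-- `ω = exp(2πi/3)`. -/
def omega : ℂ := (-1 + (Real.sqrt 3 : ℂ) * Complex.I) / 2

/-- `μ₁ = (-1 + √5)/2`. -/
def mu₁ : ℂ := (-1 + (Real.sqrt 5 : ℂ)) / 2

/-- `μ₂ = (-1 - √5)/2`. -/
def mu₂ : ℂ := (-1 - (Real.sqrt 5 : ℂ)) / 2

/-- Wiman's generators of the Valentiner group. -/
def wimanGenerators : Set (Matrix (Fin 3) (Fin 3) ℂ) :=
  {!![0, 1, 0; 0, 0, 1; 1, 0, 0],
   !![1, 0, 0; 0, -1, 0; 0, 0, -1],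
   (1 / 2 : ℂ) • !![-1, mu₂, mu₁; mu₂, mu₁, -1; mu₁, -1, mu₂],
   !![-1, 0, 0; 0, 0, -omega ^ 2; 0, -omega, 0]}

/-- The Valentiner group, of order 1080, a triple cover of the alternating group `A₆`. -/
def valentinerGroup : Subgroup (GL (Fin 3) ℂ) :=
  Subgroup.closure {g | (g : Matrix (Fin 3) (Fin 3) ℂ) ∈ wimanGenerators}

/-- The line `x = 0`, the axis of the involution `diag(1, -1, -1)`. -/
def lineX : Line := Projectivization.mk ℂ ![1, 0, 0] (by simp)

/-- The Wiman arrangement: the orbit of the line `x = 0` under the Valentiner group. As the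
involutions of that group form one conjugacy class, these are the axes of its involutions. -/
def wiman : Set Line :=
  {l | ∃ g ∈ valentinerGroup, ∀ P : Point, P ∈ l ↔ g • P ∈ lineX}

/-! ### Joining a point to the remaining singular points -/

/-- The singular points of `A` that lie on no line of `A` through `O`. -/
def remaining (A : Set Line) (O : Point) : Set Point :=
  {P ∈ Sing A | ∀ l ∈ A, O ∈ l → P ∉ l}

/-- The lines that join `O` to the singular points of `A` that lie on no line of `A` through
`O`. -/
def joins (A : Set Line) (O : Point) : Set Line :=
  {l | O ∈ l ∧ ∃ P ∈ remaining A O, P ∈ l}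

end LineArr

end

noncomputable section

namespace LineArr

open MvPolynomial

/-! The engine is a modular point: a point `O` on a line of the arrangement such that any two lines
avoiding `O` meet on a line of the arrangement through `O`. If such an `O` lies on two lines and off
a third, then the whole plane, a line through `O`, the point `O` and the empty set form a maximal
chain of modular flats (`isSupersolvable_of_isModularPoint`).

A modular point of multiplicity `m` also forces freeness with exponents `(|A| - m, m - 1)`
(`isFreeWithExponents_of_isModularPoint`). The basis consists of the Euler derivation, `P ∂_O` and
`Q ∂_v + h ∂_O`, where `P` is the product of the forms of the lines avoiding `O`, `Q` is the product
over the lines through `O` except one line `U`, and `v` is a direction in the plane `U = 0`. The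
polynomial `h` comes from Newton interpolation (`exists_interpolation`). In coordinates adapted to
`U`, `v`, `O` the three derivations are triangular, so spanning is successive division.

Adding lines through `O` creates no new line avoiding `O`, so `O` becomes modular once all joins are
present (`isModularPoint_union`). With 45 lines, 5 of them through `O`, and 85 joins, the exponents
are `45 - 5 = 40` and `5 + 85 - 1 = 89`. Another 40 arbitrary lines through `O` bring the number of
added lines to 125 and the second exponent to 129.

The numerical part is exact arithmetic in `ℤ[ω, μ₁]`: tables of the 45 lines and the 201 singular
points are checked for incidence, closure under the generators and reachability. The counts 125 and
85 are computed at one quintuple point and carried to the others by transitivity of the group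
(`quint_reached`, `HasWimanJoins.smul`). -/

/-! ### Linear forms -/

/-- The linear form with coefficients `a`. -/
def linForm (a : Fin 3 → ℂ) : MvPolynomial (Fin 3) ℂ := ∑ i, C (a i) * X i

lemma linForm_add (a b : Fin 3 → ℂ) : linForm (a + b) = linForm a + linForm b := by
  simp [linForm, add_mul, Finset.sum_add_distrib]

lemma linForm_smul (c : ℂ) (a : Fin 3 → ℂ) : linForm (c • a) = C c * linForm a := by
  simp [linForm, Finset.mul_sum, mul_assoc]

lemma linForm_sub (a b : Fin 3 → ℂ) : linForm (a - b) = linForm a - linForm b := by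
  simp [linForm, sub_mul, Finset.sum_sub_distrib]

lemma isHomogeneous_linForm (a : Fin 3 → ℂ) : (linForm a).IsHomogeneous 1 :=
  IsHomogeneous.sum _ _ _ fun _ _ => isHomogeneous_C_mul_X _ _

lemma linForm_eq_zero {a : Fin 3 → ℂ} (h : linForm a = 0) : a = 0 := by
  funext i
  have h2 := congrArg (eval (Pi.single i 1)) h
  simpa [linForm, Pi.single_apply] using h2

/-- The projection of the polynomial ring along the direction `v` onto the polynomials on the plane
`a = 0`. -/
def projAlong (a v : Fin 3 → ℂ) : MvPolynomial (Fin 3) ℂ →ₐ[ℂ] MvPolynomial (Fin 3) ℂ :=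
  aeval fun i => X i - C (v i) * linForm a

lemma projAlong_linForm (a v b : Fin 3 → ℂ) :
    projAlong a v (linForm b) = linForm (b - (b ⬝ᵥ v) • a) := by
  rw [linForm_sub, linForm_smul]
  simp only [projAlong, linForm, map_sum, map_mul, aeval_X, algHom_C, algebraMap_eq, mul_sub,
    Finset.sum_sub_distrib, dotProduct, ← mul_assoc, Finset.sum_mul]

/-- The substitution changes each variable by a multiple of `linForm a`, so it is the identity
modulo that form. -/
lemma dvd_sub_projAlong (a v : Fin 3 → ℂ) (f : MvPolynomial (Fin 3) ℂ) :
    linForm a ∣ f - projAlong a v f := by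
  have h : (Ideal.Quotient.mkₐ ℂ (Ideal.span {linForm a})).comp (projAlong a v) =
      Ideal.Quotient.mkₐ ℂ (Ideal.span {linForm a}) := by
    ext i
    simp only [AlgHom.comp_apply, projAlong, aeval_X, Ideal.Quotient.mkₐ_eq_mk, map_sub]
    rw [sub_eq_self, Ideal.Quotient.eq_zero_iff_mem]
    exact Ideal.mul_mem_left _ _ (Ideal.mem_span_singleton_self _)
  have h2 := DFunLike.congr_fun h f
  rw [AlgHom.comp_apply, Ideal.Quotient.mkₐ_eq_mk, eq_comm, Ideal.Quotient.eq,
    Ideal.mem_span_singleton] at h2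
  exact h2

/-- For `a ⬝ᵥ v = 1` the map restricts to the plane `a = 0` and extends constantly along `v`. Its
kernel is the ideal of `linForm a`, which turns divisibility into vanishing in a domain. -/
lemma linForm_dvd_iff {a v : Fin 3 → ℂ} (h : a ⬝ᵥ v = 1) {f : MvPolynomial (Fin 3) ℂ} :
    linForm a ∣ f ↔ projAlong a v f = 0 := by
  constructor
  · rintro ⟨g, rfl⟩
    rw [map_mul, projAlong_linForm, h]
    simp [linForm]
  · intro hf
    simpa [hf] using dvd_sub_projAlong a v f

lemma exists_dotProduct_eq_one {a : Fin 3 → ℂ} (ha : a ≠ 0) : ∃ v, a ⬝ᵥ v = 1 := by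
  obtain ⟨i, hi⟩ := Function.ne_iff.1 ha
  exact ⟨Pi.single i (a i)⁻¹, by simpa using mul_inv_cancel₀ hi⟩

lemma prime_linForm {a : Fin 3 → ℂ} (ha : a ≠ 0) : Prime (linForm a) := by
  obtain ⟨v, hv⟩ := exists_dotProduct_eq_one ha
  refine ⟨fun h => ha (linForm_eq_zero h), fun h => ?_, fun f g h => ?_⟩
  · have h1 := (linForm_dvd_iff hv).1 (isUnit_iff_dvd_one.1 h)
    simp at h1
  · rw [linForm_dvd_iff hv, map_mul, mul_eq_zero] at h
    simpa only [linForm_dvd_iff hv] using h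

lemma exists_smul_of_linForm_dvd {a b : Fin 3 → ℂ} (h : linForm a ∣ linForm b) :
    ∃ c : ℂ, b = c • a := by
  by_cases ha : a = 0
  · subst ha
    refine ⟨0, linForm_eq_zero ?_ |>.trans (zero_smul _ _).symm⟩
    simpa [linForm] using h
  obtain ⟨v, hv⟩ := exists_dotProduct_eq_one ha
  rw [linForm_dvd_iff hv, projAlong_linForm] at h
  exact ⟨_, sub_eq_zero.1 (linForm_eq_zero h)⟩

lemma isRelPrime_linForm {a b : Fin 3 → ℂ} (ha : a ≠ 0) (h : ∀ c : ℂ, b ≠ c • a) :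
    IsRelPrime (linForm a) (linForm b) :=
  (prime_linForm ha).irreducible.isRelPrime_iff_not_dvd.2 fun hd =>
    let ⟨c, hc⟩ := exists_smul_of_linForm_dvd hd
    h c hc

/-- Newton interpolation: if the differences of the linear forms `s ∈ S` are multiples of the forms
`t ∈ R`, each of which divides its value under `Q • ∂_{v₁}`, then `Q • ∂_{v₁} + h • ∂_{v₀}` is
logarithmic along all `s ∈ S` for some `h`. -/
lemma exists_interpolation {v₀ v₁ : Fin 3 → ℂ} {Q : MvPolynomial (Fin 3) ℂ}
    {R : Finset (Fin 3 → ℂ)}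
    (hRR : ∀ t ∈ R, ∀ t' ∈ R, t ≠ t' → ∀ c : ℂ, t' ≠ c • t)
    (hQ : ∀ t ∈ R, linForm t ∣ C (t ⬝ᵥ v₁) * Q) (S : Finset (Fin 3 → ℂ))
    (hS : ∀ s ∈ S, s ⬝ᵥ v₀ = 1)
    (hSS : ∀ s ∈ S, ∀ s' ∈ S, s ≠ s' → ∃ t ∈ R, ∃ c : ℂ, s' - s = c • t) :
    ∃ h : MvPolynomial (Fin 3) ℂ, ∀ s ∈ S, linForm s ∣ h + C (s ⬝ᵥ v₁) * Q := by
  classical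
  induction S using Finset.induction_on with
  | empty => exact ⟨0, by simp⟩
  | insert s S hs ih =>
    obtain ⟨h, hh⟩ := ih (fun x hx => hS x (Finset.mem_insert_of_mem hx))
      (fun x hx y hy => hSS x (Finset.mem_insert_of_mem hx) y (Finset.mem_insert_of_mem hy))
    have hs1 : s ⬝ᵥ v₀ = 1 := hS s (Finset.mem_insert_self _ _)
    have hSn : ∀ x ∈ S, x ⬝ᵥ v₀ = 1 := fun x hx => hS x (Finset.mem_insert_of_mem hx)
    have hSs : ∀ x, ∃ t, x ∈ S → t ∈ R ∧ ∃ c : ℂ, x - s = c • t := by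
      intro x
      by_cases hx : x ∈ S
      · obtain ⟨t, ht, hc⟩ := hSS s (Finset.mem_insert_self _ _) x (Finset.mem_insert_of_mem hx)
          (fun e => hs (e ▸ hx))
        exact ⟨t, fun _ => ⟨ht, hc⟩⟩
      · exact ⟨0, fun h => absurd h hx⟩
    choose τ hτ using hSs
    have hproj : ∀ x ∈ S, projAlong s v₀ (linForm x) = linForm (x - s) := fun x hx => by
      rw [projAlong_linForm, hSn x hx, one_smul]
    set F : MvPolynomial (Fin 3) ℂ := h + C (s ⬝ᵥ v₁) * Q with hF
    -- All forms of one class restrict to multiples of the same `t` on `s = 0`, so a power of `t`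
    -- must divide and coprimality fails there. Divisibility is therefore proved before restriction:
    -- each `x = s + c • t` divides `F - linForm s * w`, these `x` are coprime, and the term with
    -- `linForm s` dies on restriction.
    have hclass : ∀ t ∈ R, ∏ x ∈ S with τ x = t, linForm (x - s) ∣ projAlong s v₀ F := by
      intro t ht
      obtain ⟨w, hw⟩ := hQ t ht
      have h1 : ∏ x ∈ S with τ x = t, linForm x ∣ F - linForm s * w := by
        refine Finset.prod_dvd_of_isRelPrime ?_ ?_
        · intro x hx y hy hxy
          simp only [Finset.coe_filter, Set.mem_ofPred_eq] at hx hy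
          refine isRelPrime_linForm (fun e => ?_) (fun c e => hxy ?_)
          · have := hSn x hx.1
            simp [e] at this
          · have h2 := hSn y hy.1
            rw [e, smul_dotProduct, hSn x hx.1, smul_eq_mul, mul_one] at h2
            rw [e, h2, one_smul]
        · intro x hx
          simp only [Finset.mem_filter] at hx
          obtain ⟨-, c, hc⟩ := hτ x hx.1
          rw [hx.2] at hc
          have hxs : x = s + c • t := by rw [← hc]; abel
          have : F - linForm s * w = (h + C (x ⬝ᵥ v₁) * Q) - linForm x * w := by
            have e1 : C (x ⬝ᵥ v₁) * Q = C (s ⬝ᵥ v₁) * Q + C c * (linForm t * w) := by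
              rw [← hw, hxs, add_dotProduct, smul_dotProduct, smul_eq_mul, C_add, C_mul]
              ring
            rw [hF, e1, hxs, linForm_add, linForm_smul]
            ring
          rw [this]
          exact dvd_sub (hh x hx.1) (dvd_mul_right _ _)
      have h2 := map_dvd (projAlong s v₀) h1
      rw [map_prod, map_sub, map_mul, (linForm_dvd_iff hs1).1 dvd_rfl, zero_mul, sub_zero] at h2
      rwa [Finset.prod_congr rfl fun x hx => hproj x (Finset.mem_filter.1 hx).1] at h2
    -- Different classes restrict to multiples of non-proportional forms, so their products are
    -- coprime.
    have hall : ∏ x ∈ S, linForm (x - s) ∣ projAlong s v₀ F := by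
      rw [← Finset.prod_fiberwise_of_maps_to (t := R) (g := τ) fun x hx => (hτ x hx).1]
      refine Finset.prod_dvd_of_isRelPrime ?_ hclass
      intro t ht t' ht' htt
      refine IsRelPrime.prod_left fun x hx => IsRelPrime.prod_right fun y hy => ?_
      simp only [Finset.mem_filter] at hx hy
      obtain ⟨-, c, hc⟩ := hτ x hx.1
      obtain ⟨-, d, hd⟩ := hτ y hy.1
      rw [hx.2] at hc
      rw [hy.2] at hd
      have hne : ∀ z ∈ S, z - s ≠ 0 := fun z hz e => hs (sub_eq_zero.1 e ▸ hz)
      have hd0 : d ≠ 0 := fun e => hne y hy.1 (by rw [hd, e, zero_smul])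
      refine isRelPrime_linForm (hne x hx.1) fun e he => ?_
      rw [hd, hc, smul_smul] at he
      refine hRR t ht t' ht' htt (d⁻¹ * (e * c)) ?_
      rw [mul_smul, ← he, smul_smul, inv_mul_cancel₀ hd0, one_smul]
    obtain ⟨q, hq⟩ := hall
    have hidem : ∀ f, projAlong s v₀ (projAlong s v₀ f) = projAlong s v₀ f := fun f => by
      have := (linForm_dvd_iff hs1).1 (dvd_sub_projAlong s v₀ f)
      rw [map_sub, sub_eq_zero] at this
      exact this.symm
    have hq' : projAlong s v₀ F = (∏ x ∈ S, linForm (x - s)) * projAlong s v₀ q := by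
      have h1 := congrArg (projAlong s v₀) hq
      rw [hidem, map_mul, map_prod] at h1
      rw [h1]
      congr 1
      refine Finset.prod_congr rfl fun x hx => ?_
      rw [projAlong_linForm, sub_dotProduct, hSn x hx, hs1, sub_self, zero_smul, sub_zero]
    -- The Newton correction is zero modulo every earlier form and cancels `F` on the plane `s = 0`.
    refine ⟨h - (∏ x ∈ S, linForm x) * q, fun x hx => ?_⟩
    rcases Finset.mem_insert.1 hx with rfl | hx
    · rw [linForm_dvd_iff hs1]
      have : h - (∏ y ∈ S, linForm y) * q + C (x ⬝ᵥ v₁) * Q = F - (∏ y ∈ S, linForm y) * q := by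
        rw [hF]; ring
      rw [this, map_sub, hq', map_mul, map_prod, Finset.prod_congr rfl hproj, sub_self]
    · have : h - (∏ y ∈ S, linForm y) * q + C (x ⬝ᵥ v₁) * Q =
        (h + C (x ⬝ᵥ v₁) * Q) - (∏ y ∈ S, linForm y) * q := by ring
      rw [this]
      exact dvd_sub (hh x hx) ((Finset.dvd_prod_of_mem _ hx).mul_right _)

/-! ### Incidence -/

lemma mem_iff_dotProduct {P : Point} {l : Line} : P ∈ l ↔ l.rep ⬝ᵥ P.rep = 0 := by
  rw [Configuration.ofField.mem_iff]
  conv_lhs => rw [← P.mk_rep, ← l.mk_rep]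
  rw [Projectivization.orthogonal_mk, dotProduct_comm]

lemma mk_mem_mk {v w : Fin 3 → ℂ} (hv : v ≠ 0) (hw : w ≠ 0) :
    (Projectivization.mk ℂ v hv : Point) ∈ (Projectivization.mk ℂ w hw : Line) ↔
      w ⬝ᵥ v = 0 := by
  rw [Configuration.ofField.mem_iff, Projectivization.orthogonal_mk, dotProduct_comm]

lemma rep_ne_smul_rep {l m : Line} (h : l ≠ m) (c : ℂ) : m.rep ≠ c • l.rep := by
  intro e
  apply h
  rw [← l.mk_rep, ← m.mk_rep, eq_comm, Projectivization.mk_eq_mk_iff']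
  exact ⟨c, e.symm⟩

lemma eq_or_eq_of_mem {P Q : Point} {l m : Line} (h₁ : P ∈ l) (h₂ : Q ∈ l) (h₃ : P ∈ m)
    (h₄ : Q ∈ m) : P = Q ∨ l = m := by
  classical
  exact Configuration.Nondegenerate.eq_or_eq h₁ h₂ h₃ h₄

lemma exists_mem_mem (l m : Line) : ∃ P : Point, P ∈ l ∧ P ∈ m := by
  classical
  by_cases h : l = m
  · subst h
    obtain ⟨m, hm⟩ : ∃ m : Line, l ≠ m := by
      by_contra! hc
      have h := (hc (Projectivization.mk ℂ ![1, 0, 0] (by simp))).symm.trans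
        (hc (Projectivization.mk ℂ ![0, 1, 0] (by simp)))
      rw [Projectivization.mk_eq_mk_iff'] at h
      obtain ⟨a, ha⟩ := h
      simpa using congrFun ha 0
    have hP := (Configuration.HasPoints.mkPoint_ax (P := Point) (L := Line) hm).1
    exact ⟨_, hP, hP⟩
  · exact ⟨_, Configuration.HasPoints.mkPoint_ax h⟩

/-- Duality: points and lines are the same type and incidence is symmetric, so a common point of `P`
and `Q`, read as lines, is their join. -/
lemma exists_line_mem_mem (P Q : Point) : ∃ l : Line, P ∈ l ∧ Q ∈ l := by
  obtain ⟨l, h₁, h₂⟩ := exists_mem_mem P Q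
  refine ⟨l, ?_, ?_⟩
  · rwa [mem_iff_dotProduct, dotProduct_comm, ← mem_iff_dotProduct]
  · rwa [mem_iff_dotProduct, dotProduct_comm, ← mem_iff_dotProduct]

/-! ### Derivations -/

-- Multiplication by a form of degree 1 shifts the grading by one, so it commutes with taking
-- components up to that shift. This is what allows the interpolating polynomial to be made
-- homogeneous.
attribute [local instance] MvPolynomial.gradedAlgebra in
lemma linForm_dvd_homogeneousComponent {a : Fin 3 → ℂ} {f : MvPolynomial (Fin 3) ℂ}
    (h : linForm a ∣ f) (n : ℕ) : linForm a ∣ homogeneousComponent n f := by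
  obtain ⟨g, rfl⟩ := h
  have h1 := DirectSum.coe_decompose_mul_of_left_mem (homogeneousSubmodule (Fin 3) ℂ) (b := g) n
    ((mem_homogeneousSubmodule _ _).2 (isHomogeneous_linForm a))
  have h2 : (DirectSum.decompose (homogeneousSubmodule (Fin 3) ℂ) (linForm a * g) n :
    MvPolynomial (Fin 3) ℂ) = homogeneousComponent n (linForm a * g) :=
      decomposition.decompose'_apply _ _
  rw [← h2, h1]
  split_ifs
  · exact dvd_mul_right _ _
  · exact dvd_zero _

/-- The constant derivation in the direction `v`. -/
def constDer (v : Fin 3 → ℂ) :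
    Derivation ℂ (MvPolynomial (Fin 3) ℂ) (MvPolynomial (Fin 3) ℂ) :=
  mkDerivation ℂ fun i => C (v i)

lemma constDer_linForm (v a : Fin 3 → ℂ) : constDer v (linForm a) = C (a ⬝ᵥ v) := by
  simp [constDer, linForm, dotProduct, Derivation.leibniz]

/-- The Euler derivation. -/
def eulerDer : Derivation ℂ (MvPolynomial (Fin 3) ℂ) (MvPolynomial (Fin 3) ℂ) :=
  mkDerivation ℂ X

lemma eulerDer_linForm (a : Fin 3 → ℂ) : eulerDer (linForm a) = linForm a := by
  simp [eulerDer, linForm, Derivation.leibniz]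

lemma linForm_single (i : Fin 3) : linForm (Pi.single i 1) = X i := by
  simp [linForm, Pi.single_apply]

lemma derivation_eq_zero {θ : Derivation ℂ (MvPolynomial (Fin 3) ℂ) (MvPolynomial (Fin 3) ℂ)}
    (h : ∀ a, θ (linForm a) = 0) : θ = 0 :=
  derivation_ext fun i => by rw [← linForm_single, h]; rfl

/-- The dual basis of `u`, `v`, `w`, read off from the inverse matrix; the hypotheses say that its
first member is `U`. -/
lemma exists_dual_forms {U u v w : Fin 3 → ℂ} (hd : (Matrix.of ![u, v, w]).det ≠ 0)
    (hu : U ⬝ᵥ u = 1) (hv : U ⬝ᵥ v = 0) (hw : U ⬝ᵥ w = 0) :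
    ∃ b c : Fin 3 → ℂ, b ⬝ᵥ v = 1 ∧ b ⬝ᵥ w = 0 ∧ c ⬝ᵥ w = 1 ∧
      ∀ a, a = (a ⬝ᵥ u) • U + (a ⬝ᵥ v) • b + (a ⬝ᵥ w) • c := by
  set M : Matrix (Fin 3) (Fin 3) ℂ := Matrix.of ![u, v, w] with hM
  have hunit : IsUnit M.det := isUnit_iff_ne_zero.2 hd
  have hMv : ∀ a, M *ᵥ a = ![a ⬝ᵥ u, a ⬝ᵥ v, a ⬝ᵥ w] := fun a => by
    ext i
    fin_cases i <;> simp [hM, Matrix.mulVec, dotProduct_comm]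
  have hMN : ∀ a, M *ᵥ (M⁻¹ *ᵥ a) = a := fun a => by
    rw [Matrix.mulVec_mulVec, Matrix.mul_nonsing_inv _ hunit, Matrix.one_mulVec]
  have hNM : ∀ a, M⁻¹ *ᵥ (M *ᵥ a) = a := fun a => by
    rw [Matrix.mulVec_mulVec, Matrix.nonsing_inv_mul _ hunit, Matrix.one_mulVec]
  have hb := hMN ![0, 1, 0]
  have hc := hMN ![0, 0, 1]
  rw [hMv] at hb hc
  refine ⟨M⁻¹ *ᵥ ![0, 1, 0], M⁻¹ *ᵥ ![0, 0, 1], congrFun hb 1, congrFun hb 2, congrFun hc 2,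
    fun a => ?_⟩
  have hU : M⁻¹ *ᵥ ![1, 0, 0] = U := by
    rw [← hNM U, hMv, hu, hv, hw]
  rw [← hU, ← Matrix.mulVec_smul, ← Matrix.mulVec_smul, ← Matrix.mulVec_smul, ← Matrix.mulVec_add,
    ← Matrix.mulVec_add]
  conv_lhs => rw [← hNM a, hMv]
  congr 1
  ext i
  fin_cases i <;> simp

open ComplexOrder in
lemma dotProduct_star_ne_zero {v : Fin 3 → ℂ} (hv : v ≠ 0) : v ⬝ᵥ star v ≠ 0 :=
  fun h => hv (dotProduct_self_star_eq_zero.1 h)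

/-- A second direction `v` in the plane `U = 0`, transversal to `w`. -/
lemma exists_transversal {U w : Fin 3 → ℂ} (hU : U ≠ 0) (hw : w ≠ 0) (hUw : U ⬝ᵥ w = 0) :
    ∃ u v : Fin 3 → ℂ, (Matrix.of ![u, v, w]).det ≠ 0 ∧ U ⬝ᵥ u = 1 ∧ U ⬝ᵥ v = 0 := by
  have hU' := dotProduct_star_ne_zero hU
  have hw' := dotProduct_star_ne_zero hw
  -- Conjugation replaces bilinear squares, which may vanish over `ℂ`, by Hermitian norms. Since `U
  -- ⬝ᵥ w = 0`, the determinant is minus the norm of `w`.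
  refine ⟨(U ⬝ᵥ star U)⁻¹ • star U, crossProduct U (star w), ?_, ?_, ?_⟩
  · have : (Matrix.of ![(U ⬝ᵥ star U)⁻¹ • star U, crossProduct U (star w), w]).det =
      - (U ⬝ᵥ star U)⁻¹ * (U ⬝ᵥ star U) * (w ⬝ᵥ star w) +
        (U ⬝ᵥ star U)⁻¹ * (U ⬝ᵥ w) * (star U ⬝ᵥ star w) := by
      rw [Matrix.det_fin_three]
      simp [crossProduct, dotProduct, Fin.sum_univ_three]
      ring
    rw [this, hUw, mul_zero, zero_mul, add_zero]
    simp [hU', hw']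
  · rw [dotProduct_smul, smul_eq_mul, inv_mul_cancel₀ hU']
  · exact dot_self_cross _ _

/-! ### Freeness from a modular point. -/

/-- `O` is a modular point of `A`: it lies on a line of `A`, and any two lines of `A` that avoid it
meet on a line of `A` through `O`. -/
def IsModularPoint (A : Set Line) (O : Point) : Prop :=
  (∃ l ∈ A, O ∈ l) ∧ ∀ l ∈ A, ∀ m ∈ A, l ≠ m → O ∉ l → O ∉ m → ∀ P, P ∈ l → P ∈ m →
    ∃ n ∈ A, O ∈ n ∧ P ∈ n

lemma form_eq (l : Line) : l.form = linForm l.rep := rfl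

lemma isRelPrime_form {l m : Line} (h : l ≠ m) : IsRelPrime l.form m.form :=
  isRelPrime_linForm l.rep_nonzero (rep_ne_smul_rep h)

lemma dvd_of_dvd_C_mul {f g : MvPolynomial (Fin 3) ℂ} {c : ℂ} (hc : c ≠ 0)
    (h : f ∣ C c * g) : f ∣ g := by
  have := h.mul_left (C c⁻¹)
  rwa [← mul_assoc, ← C_mul, inv_mul_cancel₀ hc, C_1, one_mul] at this

/-- The logarithmic derivation of degree `m - 1` at a modular point of multiplicity `m`. -/
lemma exists_logDer_lift {A : Finset Line} {O : Point} {U : Line} {v : Fin 3 → ℂ}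
    (hmod : IsModularPoint A O) (hUv : U.rep ⬝ᵥ v = 0)
    {Q : MvPolynomial (Fin 3) ℂ} {d : ℕ} (hQd : Q.IsHomogeneous d)
    (hQ : ∀ l ∈ A, O ∈ l → l ≠ U → l.form ∣ Q) :
    ∃ h : MvPolynomial (Fin 3) ℂ, h.IsHomogeneous d ∧
      Q • constDer v + h • constDer O.rep ∈ logDer (A : Set Line) := by
  classical
  set w := O.rep with hw
  have hmem : ∀ l : Line, O ∈ l ↔ l.rep ⬝ᵥ w = 0 := fun l => mem_iff_dotProduct
  -- Forms scaled to the value 1 at `w`, so that the difference of two of them vanishes at `O`.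
  set N : Line → Fin 3 → ℂ := fun l => (l.rep ⬝ᵥ w)⁻¹ • l.rep with hN
  have hN1 : ∀ l : Line, O ∉ l → N l ⬝ᵥ w = 1 := fun l hl => by
    rw [hN, smul_dotProduct, smul_eq_mul, inv_mul_cancel₀ (mt (hmem l).2 hl)]
  obtain ⟨h, hh⟩ := exists_interpolation (v₀ := w) (v₁ := v) (Q := Q)
    (R := (A.filter (O ∈ ·)).image Projectivization.rep) (by
      intro t ht t' ht' htt c
      obtain ⟨l, -, rfl⟩ := Finset.mem_image.1 ht
      obtain ⟨l', -, rfl⟩ := Finset.mem_image.1 ht'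
      exact rep_ne_smul_rep (fun e => htt (by rw [e])) c) (by
      intro t ht
      obtain ⟨l, hl, rfl⟩ := Finset.mem_image.1 ht
      rw [Finset.mem_filter] at hl
      by_cases hlU : l = U
      · rw [hlU, hUv, C_0, zero_mul]
        exact dvd_zero _
      · exact (hQ l hl.1 hl.2 hlU).mul_left _)
    ((A.filter (O ∉ ·)).image N) (by
      intro s hs
      obtain ⟨l, hl, rfl⟩ := Finset.mem_image.1 hs
      exact hN1 l (Finset.mem_filter.1 hl).2) (by
      intro s hs s' hs' hss
      obtain ⟨l, hl, rfl⟩ := Finset.mem_image.1 hs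
      obtain ⟨m, hm, rfl⟩ := Finset.mem_image.1 hs'
      rw [Finset.mem_filter] at hl hm
      obtain ⟨P, hPl, hPm⟩ := exists_mem_mem l m
      obtain ⟨n, hn, hOn, hPn⟩ := hmod.2 l hl.1 m hm.1 (fun e => hss (by rw [e])) hl.2 hm.2 P
        hPl hPm
      refine ⟨n.rep, Finset.mem_image_of_mem _ (Finset.mem_filter.2 ⟨hn, hOn⟩), ?_⟩
      -- This difference vanishes at `O` and at `P`, hence defines the line `n` that modularity
      -- supplies.
      have hd : N m - N l ≠ 0 := sub_ne_zero.2 hss.symm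
      rw [mem_iff_dotProduct] at hPl hPm
      have hPd : P ∈ (Projectivization.mk ℂ _ hd : Line) := by
        rw [← P.mk_rep, mk_mem_mk P.rep_nonzero hd, sub_dotProduct, hN, smul_dotProduct,
          smul_dotProduct, hPl, hPm, smul_zero, smul_zero, sub_zero]
      have hOd : O ∈ (Projectivization.mk ℂ _ hd : Line) := by
        rw [← O.mk_rep, mk_mem_mk O.rep_nonzero hd, sub_dotProduct, hN1 m hm.2, hN1 l hl.2,
          sub_self]
      have hPO : P ≠ O := fun e => hl.2 (by rw [← e, mem_iff_dotProduct, hPl])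
      have hnd := (eq_or_eq_of_mem hPd hOd hPn hOn).resolve_left hPO
      rw [← n.mk_rep, Projectivization.mk_eq_mk_iff'] at hnd
      obtain ⟨c, hc⟩ := hnd
      exact ⟨c, hc.symm⟩)
  -- As `Q` is homogeneous of degree `d`, the component of `h` in that degree satisfies the same
  -- divisibilities.
  refine ⟨homogeneousComponent d h, homogeneousComponent_isHomogeneous _ _, fun l hl => ?_⟩
  rw [Ideal.mem_span_singleton, Derivation.add_apply, Derivation.smul_apply, Derivation.smul_apply,
    form_eq, constDer_linForm, constDer_linForm, smul_eq_mul, smul_eq_mul]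
  by_cases hO : O ∈ l
  · rw [(hmem l).1 hO, C_0, mul_zero, add_zero]
    by_cases hlU : l = U
    · rw [hlU, hUv, C_0, mul_zero]
      exact dvd_zero _
    · exact (hQ l hl hO hlU).mul_right _
  · have h0 : l.rep ⬝ᵥ w ≠ 0 := mt (hmem l).2 hO
    have hl' : l.rep = (l.rep ⬝ᵥ w) • N l := by
      rw [hN, smul_smul, mul_inv_cancel₀ h0, one_smul]
    have h1 := linForm_dvd_homogeneousComponent
      (hh (N l) (Finset.mem_image_of_mem _ (Finset.mem_filter.2 ⟨hl, hO⟩))) d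
    rw [map_add, homogeneousComponent_C_mul, (homogeneousComponent_of_mem hQd : _ = ite _ _ _),
      if_pos rfl] at h1
    have h2 := mul_dvd_mul_left (C (l.rep ⬝ᵥ w)) h1
    rw [← linForm_smul, ← hl'] at h2
    convert h2 using 1
    have h3 : l.rep ⬝ᵥ v = (l.rep ⬝ᵥ w) * (N l ⬝ᵥ v) := by
      conv_lhs => rw [hl', smul_dotProduct, smul_eq_mul]
    rw [h3, C_mul]
    ring

/-- An arrangement with a modular point of multiplicity `m` is free with exponents
`(|A| - m, m - 1)`. -/
theorem isFreeWithExponents_of_isModularPoint {A : Set Line} (hA : A.Finite) {O : Point}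
    (hmod : IsModularPoint A O) :
    IsFreeWithExponents A (A.ncard - mult A O) (mult A O - 1) := by
  classical
  lift A to Finset Line using hA
  obtain ⟨U, hUA, hOU⟩ := hmod.1
  have hmem : ∀ l : Line, O ∈ l ↔ l.rep ⬝ᵥ O.rep = 0 := fun l => mem_iff_dotProduct
  obtain ⟨u, v, hdet, hUu, hUv⟩ :=
    exists_transversal U.rep_nonzero O.rep_nonzero ((hmem U).1 hOU)
  obtain ⟨b, c, hbv, hbw, hcw, hdual⟩ := exists_dual_forms hdet hUu hUv ((hmem U).1 hOU)
  set S : Finset Line := A.filter (O ∉ ·) with hS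
  set T : Finset Line := (A.filter (O ∈ ·)).erase U with hT
  set P : MvPolynomial (Fin 3) ℂ := ∏ l ∈ S, l.form with hP
  set Q : MvPolynomial (Fin 3) ℂ := ∏ l ∈ T, l.form with hQ
  have hUT : U ∈ A.filter (O ∈ ·) := Finset.mem_filter.2 ⟨hUA, hOU⟩
  have hmult : mult (A : Set Line) O = (A.filter (O ∈ ·)).card := by
    rw [mult, ← Set.ncard_coe_finset]
    congr 1
    ext l
    simp
  have hTcard : T.card = mult (A : Set Line) O - 1 := by
    rw [hmult, hT, Finset.card_erase_of_mem hUT]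
  have hScard : S.card = (A : Set Line).ncard - mult (A : Set Line) O := by
    rw [hmult, Set.ncard_coe_finset, ← Finset.card_filter_add_card_filter_not (s := A) (O ∈ ·),
      Nat.add_sub_cancel_left]
  have hPd : P.IsHomogeneous S.card := by
    simpa using IsHomogeneous.prod S (fun l : Line => l.form) (fun _ => 1)
      fun l _ => isHomogeneous_linForm l.rep
  have hQd : Q.IsHomogeneous T.card := by
    simpa using IsHomogeneous.prod T (fun l : Line => l.form) (fun _ => 1)
      fun l _ => isHomogeneous_linForm l.rep
  obtain ⟨h, hhd, hθ⟩ := exists_logDer_lift (U := U) hmod hUv hQd fun l hl hO hlU =>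
    Finset.dvd_prod_of_mem _ (Finset.mem_erase.2 ⟨hlU, Finset.mem_filter.2 ⟨hl, hO⟩⟩)
  have hE : eulerDer ∈ logDer (A : Set Line) := fun l _ => by
    rw [form_eq, eulerDer_linForm]
    exact Ideal.mem_span_singleton_self _
  have hφ : P • constDer O.rep ∈ logDer (A : Set Line) := fun l hl => by
    rw [form_eq, Derivation.smul_apply, constDer_linForm, smul_eq_mul, Ideal.mem_span_singleton]
    by_cases hO : O ∈ l
    · rw [(hmem l).1 hO, C_0, mul_zero]
      exact dvd_zero _
    · exact (Finset.dvd_prod_of_mem (fun l : Line => l.form)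
        (Finset.mem_filter.2 ⟨hl, hO⟩)).mul_right _
  have hP0 : P ≠ 0 := Finset.prod_ne_zero_iff.2 fun l _ => (prime_linForm l.rep_nonzero).ne_zero
  have hQ0 : Q ≠ 0 := Finset.prod_ne_zero_iff.2 fun l _ => (prime_linForm l.rep_nonzero).ne_zero
  have hU0 : linForm U.rep ≠ 0 := (prime_linForm U.rep_nonzero).ne_zero
  set θ := Q • constDer v + h • constDer O.rep with hθdef
  set φ := P • constDer O.rep with hφdef
  have θU : θ (linForm U.rep) = 0 := by
    simp [hθdef, constDer_linForm, hUv, (hmem U).1 hOU]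
  have φU : φ (linForm U.rep) = 0 := by
    simp [hφdef, constDer_linForm, (hmem U).1 hOU]
  have θb : θ (linForm b) = Q := by
    simp [hθdef, constDer_linForm, hbv, hbw]
  have φb : φ (linForm b) = 0 := by
    simp [hφdef, constDer_linForm, hbw]
  have φc : φ (linForm c) = P := by
    simp [hφdef, constDer_linForm, hcw]
  have hexp : ∀ (ψ : Derivation ℂ (MvPolynomial (Fin 3) ℂ) (MvPolynomial (Fin 3) ℂ)) a,
      ψ (linForm a) = C (a ⬝ᵥ u) * ψ (linForm U.rep) + C (a ⬝ᵥ v) * ψ (linForm b) +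
        C (a ⬝ᵥ O.rep) * ψ (linForm c) := fun ψ a => by
    conv_lhs => rw [hdual a, linForm_add, linForm_add, linForm_smul, linForm_smul, linForm_smul]
    simp [Derivation.leibniz, derivation_C]
  -- Evaluation at `U`, `b`, `c` is triangular with the nonzero diagonal entries `linForm U.rep`,
  -- `Q`, `P`.
  have hli : LinearIndependent (MvPolynomial (Fin 3) ℂ)
      (![⟨eulerDer, hE⟩, ⟨φ, hφ⟩, ⟨θ, hθ⟩] : Fin 3 → logDer (A : Set Line)) := by
    rw [Fintype.linearIndependent_iffₛ]
    intro g₁ g₂ hg i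
    rw [← sub_eq_zero]
    set g := g₁ - g₂ with hgdef
    change g i = 0
    have hg' : g₁ 0 • eulerDer + g₁ 1 • φ + g₁ 2 • θ =
        g₂ 0 • eulerDer + g₂ 1 • φ + g₂ 2 • θ := by
      have := congrArg Subtype.val hg
      simp only [Fin.sum_univ_three] at this
      exact this
    have happ : ∀ a, g 0 * linForm a + g 1 * φ (linForm a) + g 2 * θ (linForm a) = 0 := fun a => by
      have := DFunLike.congr_fun hg' (linForm a)
      simp only [Derivation.add_apply, Derivation.smul_apply, smul_eq_mul, eulerDer_linForm] at this
      simp only [hgdef, Pi.sub_apply]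
      linear_combination this
    have g0 : g 0 = 0 := by
      have := happ U.rep
      rw [θU, φU, mul_zero, mul_zero, add_zero, add_zero] at this
      exact (mul_eq_zero.1 this).resolve_right hU0
    have g2 : g 2 = 0 := by
      have := happ b
      rw [g0, θb, φb, zero_mul, mul_zero, zero_add, zero_add] at this
      exact (mul_eq_zero.1 this).resolve_right hQ0
    have g1 : g 1 = 0 := by
      have := happ c
      rw [g0, g2, φc, zero_mul, zero_mul, zero_add, add_zero] at this
      exact (mul_eq_zero.1 this).resolve_right hP0
    fin_cases i <;> assumption
  have hspan : ⊤ ≤ Submodule.span (MvPolynomial (Fin 3) ℂ) (Set.range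
      (![⟨eulerDer, hE⟩, ⟨φ, hφ⟩, ⟨θ, hθ⟩] : Fin 3 → logDer (A : Set Line))) := by
    rintro ⟨ψ, hψ⟩ -
    have hdvd : ∀ χ ∈ logDer (A : Set Line), ∀ l ∈ A, l.form ∣ χ (linForm l.rep) :=
      fun χ hχ l hl => Ideal.mem_span_singleton.1 (hχ l hl)
    obtain ⟨x, hx⟩ := hdvd ψ hψ U hUA
    set ψ₁ := ψ - x • eulerDer with hψ₁
    have m₁ : ψ₁ ∈ logDer (A : Set Line) := sub_mem hψ (Submodule.smul_mem _ x hE)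
    have ψ₁U : ψ₁ (linForm U.rep) = 0 := by
      simp [hψ₁, eulerDer_linForm, hx, form_eq, mul_comm]
    -- A line through `O` other than `U` is a combination of `U` and `b` with nonzero coefficient at
    -- `b`. Since `ψ₁` kills `U`, the form of that line divides `ψ₁ (linForm b)`.
    obtain ⟨y, hy⟩ : Q ∣ ψ₁ (linForm b) := by
      refine Finset.prod_dvd_of_isRelPrime (fun l _ m _ hlm => isRelPrime_form hlm)
        fun l hl => ?_
      rw [hT, Finset.mem_erase, Finset.mem_filter] at hl
      have hlv : l.rep ⬝ᵥ v ≠ 0 := fun e => by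
        refine rep_ne_smul_rep hl.1.symm (l.rep ⬝ᵥ u) ?_
        conv_lhs => rw [hdual l.rep, e, (hmem l).1 hl.2.2, zero_smul, zero_smul, add_zero, add_zero]
      have := hdvd ψ₁ m₁ l hl.2.1
      rw [hexp, ψ₁U, (hmem l).1 hl.2.2, C_0, mul_zero, zero_mul, zero_add, add_zero] at this
      exact dvd_of_dvd_C_mul hlv this
    set ψ₂ := ψ₁ - y • θ with hψ₂
    have m₂ : ψ₂ ∈ logDer (A : Set Line) := sub_mem m₁ (Submodule.smul_mem _ y hθ)
    have ψ₂U : ψ₂ (linForm U.rep) = 0 := by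
      simp [hψ₂, ψ₁U, θU]
    have ψ₂b : ψ₂ (linForm b) = 0 := by
      simp [hψ₂, hy, θb, mul_comm]
    -- Now `U` and `b` are both killed, so on a line avoiding `O` only the nonzero coefficient at
    -- `c` survives.
    obtain ⟨z, hz⟩ : P ∣ ψ₂ (linForm c) := by
      refine Finset.prod_dvd_of_isRelPrime (fun l _ m _ hlm => isRelPrime_form hlm)
        fun l hl => ?_
      rw [hS, Finset.mem_filter] at hl
      have := hdvd ψ₂ m₂ l hl.1
      rw [hexp, ψ₂U, ψ₂b, mul_zero, mul_zero, zero_add, zero_add] at this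
      exact dvd_of_dvd_C_mul (mt (hmem l).2 hl.2) this
    have h0 : ψ₂ - z • φ = 0 := derivation_eq_zero fun a => by
      rw [hexp]
      simp [ψ₂U, ψ₂b, hz, φU, φb, φc, mul_comm]
    have hsum : (⟨ψ, hψ⟩ : logDer (A : Set Line)) =
        x • ⟨eulerDer, hE⟩ + z • ⟨φ, hφ⟩ + y • ⟨θ, hθ⟩ := by
      apply Subtype.ext
      change ψ = x • eulerDer + z • φ + y • θ
      rw [← sub_eq_zero, ← h0, hψ₂, hψ₁]
      abel
    rw [hsum]
    refine add_mem (add_mem ?_ ?_) ?_ <;> refine Submodule.smul_mem _ _ (Submodule.subset_span ?_)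
    · exact ⟨0, rfl⟩
    · exact ⟨1, rfl⟩
    · exact ⟨2, rfl⟩
  refine ⟨Module.Basis.mk hli hspan, fun i j => ?_⟩
  rw [Module.Basis.mk_apply, ← hScard, ← hTcard]
  have hconst : ∀ w : Fin 3 → ℂ, constDer w (X j) = C (w j) := fun w => by
    simp [constDer]
  fin_cases i
  · simpa [eulerDer] using isHomogeneous_X ℂ j
  · simpa [hφdef, hconst] using hPd.mul (isHomogeneous_C (Fin 3) (O.rep j))
  · simpa [hθdef, hconst] using (hQd.mul (isHomogeneous_C (Fin 3) (v j))).add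
      (hhd.mul (isHomogeneous_C (Fin 3) (O.rep j)))

/-! ### Supersolvability from a modular point -/

lemma exists_ne_mem (l : Line) : ∃ P Q : Point, P ≠ Q ∧ P ∈ l ∧ Q ∈ l := by
  classical
  obtain ⟨P, hP, -⟩ := exists_mem_mem l l
  obtain ⟨m, hm⟩ := Configuration.Nondegenerate.exists_line (L := Line) P
  obtain ⟨Q, hQl, hQm⟩ := exists_mem_mem l m
  exact ⟨P, Q, fun e => hm (e ▸ hQm), hP, hQl⟩

lemma eq_of_pts_subset {l m : Line} (h : Line.pts l ⊆ Line.pts m) : l = m := by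
  obtain ⟨P, Q, hPQ, hP, hQ⟩ := exists_ne_mem l
  exact (eq_or_eq_of_mem hP hQ (h hP) (h hQ)).resolve_left hPQ

lemma flat_cases {A : Set Line} (X : IntersectionLattice A) :
    X.1 = Set.univ ∨ (∃ l ∈ A, X.1 = Line.pts l) ∨ (∃ P, X.1 = {P}) ∨ X.1 = ∅ := by
  obtain ⟨X, B, hB, rfl⟩ := X
  rcases B.eq_empty_or_nonempty with rfl | ⟨l, hl⟩
  · simp
  by_cases h : ∃ m ∈ B, l ≠ m
  · obtain ⟨m, hm, hlm⟩ := h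
    have hsub : (⋂ l ∈ B, Line.pts l).Subsingleton := fun P hP Q hQ => by
      rw [Set.mem_iInter₂] at hP hQ
      exact (eq_or_eq_of_mem (hP l hl) (hQ l hl) (hP m hm) (hQ m hm)).resolve_right hlm
    rcases hsub.eq_empty_or_singleton with h | h
    · exact Or.inr (Or.inr (Or.inr h))
    · exact Or.inr (Or.inr (Or.inl h))
  · push Not at h
    have hBl : B = {l} := Set.eq_singleton_iff_unique_mem.2 ⟨hl, fun m hm => (h m hm).symm⟩
    exact Or.inr (Or.inl ⟨l, hB hl, by simp [hBl]⟩)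

/-- A criterion for the modularity of a flat, in terms of point sets. -/
lemma isModularElement_of_forall {A : Set Line} {X : IntersectionLattice A}
    (h : ∀ Y Z : IntersectionLattice A, Y.1 ⊆ Z.1 → ∀ l ∈ A, Z.1 ∩ X.1 ⊆ Line.pts l →
      Y.1 ⊆ Line.pts l → ¬ X.1 ⊆ Line.pts l → ¬ Z.1 ⊆ Line.pts l → ∀ P ∈ Z.1,
        (∀ m ∈ A, X.1 ⊆ Line.pts m → Y.1 ⊆ Line.pts m → P ∈ m) → P ∈ l) :
    IsModularElement X := by
  intro Y Z hZY
  -- One inequality of the modular law holds in every lattice; only the other is tested on points.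
  refine le_antisymm (sup_le (le_inf le_sup_left hZY)
    (le_inf (inf_le_left.trans le_sup_right) inf_le_right)) ?_
  rintro P ⟨hPZ, hP⟩
  change P ∈ ⋂ l ∈ {l ∈ A | Z.1 ∩ X.1 ⊆ Line.pts l ∧ Y.1 ⊆ Line.pts l}, Line.pts l
  replace hP : P ∈ ⋂ l ∈ {l ∈ A | X.1 ⊆ Line.pts l ∧ Y.1 ⊆ Line.pts l}, Line.pts l := hP
  rw [Set.mem_iInter₂] at hP ⊢
  rintro l ⟨hl, hZX, hYl⟩
  by_cases hX : X.1 ⊆ Line.pts l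
  · exact hP l ⟨hl, hX, hYl⟩
  by_cases hZ : Z.1 ⊆ Line.pts l
  · exact hZ hPZ
  exact h Y Z hZY l hl hZX hYl hX hZ P hPZ fun m hm hXm hYm => hP m ⟨hm, hXm, hYm⟩

/-- Atoms are always modular. In the critical case `Z` is a line `m`: then `l` and `m` share a point
of `U` and a point off `U`, so they coincide. -/
lemma isModularElement_line {A : Set Line} {X : IntersectionLattice A} {U : Line} (hU : U ∈ A)
    (hX : X.1 = Line.pts U) : IsModularElement X := by
  refine isModularElement_of_forall fun Y Z hYZ l hl hZX hYl hXl hZl P hPZ hP => ?_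
  rw [hX] at hZX hP hXl
  by_cases hYU : Y.1 ⊆ Line.pts U
  · exact hZX ⟨hPZ, hP U hU subset_rfl hYU⟩
  obtain ⟨R, hRY, hRU⟩ := Set.not_subset.1 hYU
  rcases flat_cases Z with h | ⟨m, -, h⟩ | ⟨T, h⟩ | h
  · rw [h, Set.univ_inter] at hZX
    exact absurd hZX hXl
  · obtain ⟨T, hTm, hTU⟩ := exists_mem_mem m U
    have hTl : T ∈ l := hZX ⟨h ▸ hTm, hTU⟩
    have hRm : R ∈ m := by
      have := hYZ hRY
      rwa [h] at this
    have hlm := (eq_or_eq_of_mem hTl (hYl hRY) hTm hRm).resolve_left fun e => hRU (e ▸ hTU)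
    exact absurd h.subset (hlm ▸ hZl)
  · have hR : R ∈ Z.1 := hYZ hRY
    rw [h] at hR hPZ
    rw [hPZ, ← hR]
    exact hYl hRY
  · rw [h] at hPZ
    exact hPZ.elim

/-- In the critical case `Z` is a line `m` meeting `l` in `R`, both avoiding `O`. Modularity gives a
line `n` of `A` through `O` and `R`, which confines `P` to `n ∩ m = {R}`. The two lines through `O`
serve the case of empty `Y`. -/
lemma isModularElement_point {A : Set Line} {X : IntersectionLattice A} {O : Point}
    (hO : IsModularPoint A O) {l₁ l₂ : Line} (h₁ : l₁ ∈ A) (h₂ : l₂ ∈ A) (h₁₂ : l₁ ≠ l₂)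
    (hO₁ : O ∈ l₁) (hO₂ : O ∈ l₂) (hX : X.1 = {O}) : IsModularElement X := by
  refine isModularElement_of_forall fun Y Z hYZ l hl hZX hYl hXl hZl P hPZ hP => ?_
  rw [hX, Set.singleton_subset_iff] at hXl
  simp only [hX, Set.singleton_subset_iff] at hP
  rw [hX] at hZX
  have hOZ : O ∉ Z.1 := fun h => hXl (hZX ⟨h, rfl⟩)
  rcases Y.1.eq_empty_or_nonempty with hY | ⟨R, hRY⟩
  · have hPO : P = O := by
      refine (eq_or_eq_of_mem ?_ hO₁ ?_ hO₂).resolve_right h₁₂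
      · exact hP l₁ h₁ hO₁ (hY ▸ Set.empty_subset _)
      · exact hP l₂ h₂ hO₂ (hY ▸ Set.empty_subset _)
    exact absurd (hPO ▸ hPZ) hOZ
  have hRZ := hYZ hRY
  have hRl := hYl hRY
  rcases flat_cases Z with h | ⟨m, hm, h⟩ | ⟨T, h⟩ | h
  · rw [h] at hOZ
    exact absurd (Set.mem_univ _) hOZ
  · rw [h] at hPZ hRZ hOZ hZl
    have hlm : l ≠ m := fun e => hZl (e ▸ subset_rfl)
    obtain ⟨n, hn, hOn, hRn⟩ := hO.2 l hl m hm hlm hXl hOZ R hRl hRZ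
    have hYR : Y.1 ⊆ Line.pts n := fun S hS => by
      have hSm : S ∈ m := by
        have := hYZ hS
        rwa [h] at this
      rwa [(eq_or_eq_of_mem (hYl hS) hRl hSm hRZ).resolve_right hlm]
    have hPn : P ∈ n := hP n hn hOn hYR
    rw [(eq_or_eq_of_mem hPZ hRZ hPn hRn).resolve_right fun e => hOZ (e ▸ hOn)]
    exact hRl
  · rw [h] at hPZ hRZ
    rw [hPZ, ← hRZ]
    exact hRl
  · rw [h] at hPZ
    exact hPZ.elim

/-- A modular point on at least two lines, not on all lines, makes an arrangement
supersolvable. -/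
theorem isSupersolvable_of_isModularPoint {A : Set Line} {O : Point} (hO : IsModularPoint A O)
    {l₀ l₁ l₂ : Line} (h₀ : l₀ ∈ A) (h₁ : l₁ ∈ A) (h₂ : l₂ ∈ A) (h₁₂ : l₁ ≠ l₂)
    (hO₀ : O ∉ l₀) (hO₁ : O ∈ l₁) (hO₂ : O ∈ l₂) : IsSupersolvable A := by
  have hpt : Line.pts l₁ ∩ Line.pts l₂ = {O} := Set.eq_singleton_iff_unique_mem.2
    ⟨⟨hO₁, hO₂⟩, fun P hP => (eq_or_eq_of_mem hP.1 hO₁ hP.2 hO₂).resolve_right h₁₂⟩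
  let x₀ : IntersectionLattice A := ⟨Set.univ, ∅, Set.empty_subset _, by simp⟩
  let x₁ : IntersectionLattice A := ⟨Line.pts l₁, {l₁}, by simpa using h₁, by simp⟩
  let x₂ : IntersectionLattice A := ⟨{O}, {l₁, l₂}, Set.pair_subset h₁ h₂, by
    rw [Set.biInter_pair, hpt]⟩
  let x₃ : IntersectionLattice A := ⟨∅, {l₀, l₁, l₂},
    Set.insert_subset h₀ (Set.pair_subset h₁ h₂), by
      rw [Set.biInter_insert, Set.biInter_pair, hpt, eq_comm, Set.eq_empty_iff_forall_notMem]
      rintro P ⟨hP, rfl⟩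
      exact hO₀ hP⟩
  have h01 : x₀ ≤ x₁ := Set.subset_univ _
  have h12 : x₁ ≤ x₂ := Set.singleton_subset_iff.2 hO₁
  have h23 : x₂ ≤ x₃ := Set.empty_subset _
  refine ⟨{x₀, x₁, x₂, x₃}, ⟨?_, ?_⟩, ?_⟩
  · have h02 := h01.trans h12
    have h13 := h12.trans h23
    have h03 := h01.trans h13
    rintro x (rfl | rfl | rfl | rfl) y (rfl | rfl | rfl | rfl) hxy <;>
      first
      | exact absurd rfl hxy
      | exact Or.inl (by assumption)
      | exact Or.inr (by assumption)
  -- Maximality: a flat comparable with the whole chain equals the chain member of its own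
  -- dimension.
  · intro c hc hsub
    refine Set.Subset.antisymm hsub fun y hy => ?_
    have hcomp : ∀ x ∈ ({x₀, x₁, x₂, x₃} : Set (IntersectionLattice A)),
        y.1 ⊆ x.1 ∨ x.1 ⊆ y.1 := fun x hx => by
      by_cases e : x = y
      · exact Or.inl (e ▸ subset_rfl)
      · exact hc (hsub hx) hy e
    rcases flat_cases y with h | ⟨l, -, h⟩ | ⟨P, h⟩ | h
    · exact Or.inl (Subtype.ext h)
    · refine Or.inr (Or.inl (Subtype.ext (h.trans ?_)))
      rcases hcomp x₁ (by simp) with h' | h'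
      · rw [h] at h'
        exact congrArg Line.pts (eq_of_pts_subset h')
      · rw [h] at h'
        exact congrArg Line.pts (eq_of_pts_subset h').symm
    · refine Or.inr (Or.inr (Or.inl (Subtype.ext (h.trans ?_))))
      rcases hcomp x₂ (by simp) with h' | h'
      · rw [h] at h'
        rw [Set.singleton_subset_iff.1 h']
      · rw [h] at h'
        rw [← Set.singleton_subset_iff.1 h']
    · exact Or.inr (Or.inr (Or.inr (Subtype.ext h)))
  · rintro x (rfl | rfl | rfl | rfl)
    · refine isModularElement_of_forall fun Y Z _ l _ hZX _ _ hZl => ?_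
      exact absurd ((Set.inter_univ Z.1).symm.subset.trans hZX) hZl
    · exact isModularElement_line h₁ rfl
    · exact isModularElement_point hO h₁ h₂ h₁₂ hO₁ hO₂ rfl
    · exact isModularElement_of_forall fun Y Z _ l _ _ _ hX => absurd (Set.empty_subset _) hX

/-! ### Adding lines through a point -/

lemma ncard_union_of_disjoint {A K : Set Line} (hA : A.Finite) (hK : K.Finite)
    (h : Disjoint A K) : (A ∪ K).ncard = A.ncard + K.ncard :=
  Set.ncard_union_eq h hA hK

lemma disjoint_joins (A : Set Line) (O : Point) : Disjoint A (joins A O) := by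
  rw [Set.disjoint_left]
  rintro l hl ⟨hO, P, hP, hPl⟩
  exact hP.2 l hl hO hPl

/-- Lines avoiding `O` all belong to `A`. Their intersections either lie on a line of `A` through
`O` or are remaining points, whose joins with `O` are in `K`. -/
lemma isModularPoint_union {A K : Set Line} {O : Point} (hA : ∃ l ∈ A, O ∈ l)
    (hJ : joins A O ⊆ K) (hK : ∀ l ∈ K, O ∈ l) : IsModularPoint (A ∪ K) O := by
  obtain ⟨l, hl, hO⟩ := hA
  refine ⟨⟨l, Or.inl hl, hO⟩, fun l hl m hm hlm hOl hOm P hPl hPm => ?_⟩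
  replace hl := hl.resolve_right fun h => hOl (hK l h)
  replace hm := hm.resolve_right fun h => hOm (hK m h)
  by_cases h : ∃ n ∈ A, O ∈ n ∧ P ∈ n
  · obtain ⟨n, hn, h⟩ := h
    exact ⟨n, Or.inl hn, h⟩
  · push Not at h
    obtain ⟨n, hOn, hPn⟩ := exists_line_mem_mem O P
    exact ⟨n, Or.inr (hJ ⟨hOn, P, ⟨⟨l, hl, m, hm, hlm, hPl, hPm⟩, h⟩, hPn⟩), hOn, hPn⟩

lemma mult_union {A K : Set Line} {O : Point} (hA : A.Finite) (hK : K.Finite)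
    (hKO : ∀ l ∈ K, O ∈ l) (hd : Disjoint A K) : mult (A ∪ K) O = mult A O + K.ncard := by
  have h : {l ∈ A ∪ K | O ∈ l} = {l ∈ A | O ∈ l} ∪ K := by
    ext l
    constructor
    · rintro ⟨h | h, hO⟩
      · exact Or.inl ⟨h, hO⟩
      · exact Or.inr h
    · rintro (h | h)
      · exact ⟨Or.inl h.1, h.2⟩
      · exact ⟨Or.inr h, hKO l h⟩
  rw [mult, h, ncard_union_of_disjoint (hA.subset fun _ h => h.1) hK
    (hd.mono_left fun _ h => h.1), mult]

lemma exists_lines_of_mult {A : Set Line} {O : Point} (hA : A.Finite) (h2 : 2 ≤ mult A O)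
    (hlt : mult A O < A.ncard) : ∃ l₀ ∈ A, ∃ l₁ ∈ A, ∃ l₂ ∈ A, l₁ ≠ l₂ ∧ O ∉ l₀ ∧ O ∈ l₁ ∧
      O ∈ l₂ := by
  obtain ⟨l₁, l₂, h₁, h₂, h₁₂⟩ := (Set.one_lt_ncard_iff (hA.subset fun _ h => h.1)).1 h2
  obtain ⟨l₀, h₀, h₀'⟩ := Set.exists_mem_notMem_of_ncard_lt_ncard hlt
    (hA.subset fun _ h => h.1)
  exact ⟨l₀, h₀, l₁, h₁.1, l₂, h₂.1, h₁₂, fun h => h₀' ⟨h₀, h⟩, h₁.2, h₂.2⟩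

/-- Adding lines through `O` that include all joins yields a supersolvable free arrangement. -/
theorem isSupersolvable_union {A K : Set Line} {O : Point} (hAf : A.Finite)
    (h2 : 2 ≤ mult A O) (hlt : mult A O < A.ncard)
    (hJ : joins A O ⊆ K) (hK : ∀ l ∈ K, O ∈ l) : IsSupersolvable (A ∪ K) := by
  obtain ⟨l₀, h₀, l₁, h₁, l₂, h₂, h₁₂, hO₀, hO₁, hO₂⟩ := exists_lines_of_mult hAf h2 hlt
  exact isSupersolvable_of_isModularPoint (isModularPoint_union ⟨l₁, h₁, hO₁⟩ hJ hK)
    (Or.inl h₀) (Or.inl h₁) (Or.inl h₂) h₁₂ hO₀ hO₁ hO₂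

/-- Each line of `K` raises both the total and the multiplicity at `O` by one, so only the second
exponent grows. -/
theorem isFreeWithExponents_union {A K : Set Line} {O : Point} (hAf : A.Finite) (hKf : K.Finite)
    (hd : Disjoint A K) (h2 : 2 ≤ mult A O) (hlt : mult A O < A.ncard)
    (hJ : joins A O ⊆ K) (hK : ∀ l ∈ K, O ∈ l) :
    IsFreeWithExponents (A ∪ K) (A.ncard - mult A O) (mult A O + K.ncard - 1) := by
  obtain ⟨l₀, h₀, l₁, h₁, l₂, h₂, h₁₂, hO₀, hO₁, hO₂⟩ := exists_lines_of_mult hAf h2 hlt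
  have h := isFreeWithExponents_of_isModularPoint (hAf.union hKf)
    (isModularPoint_union ⟨l₁, h₁, hO₁⟩ hJ hK)
  rwa [mult_union hAf hKf hK hd, ncard_union_of_disjoint hAf hKf hd,
    Nat.add_sub_add_right] at h

/-- The lines `l₁ + c l₂` are pairwise distinct members of the pencil. They make room for padding a
resolution with lines through `O`. -/
lemma infinite_pencil (O : Point) {l₁ l₂ : Line} (h₁₂ : l₁ ≠ l₂) (h₁ : O ∈ l₁) (h₂ : O ∈ l₂) :
    {l : Line | O ∈ l}.Infinite := by
  have hne : ∀ c : ℂ, l₁.rep + c • l₂.rep ≠ 0 := fun c h =>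
    rep_ne_smul_rep h₁₂.symm (-c) (by rw [neg_smul]; exact eq_neg_of_add_eq_zero_left h)
  refine Set.infinite_of_injective_forall_mem
    (f := fun c : ℂ => (Projectivization.mk ℂ _ (hne c) : Line)) (fun c d hcd => ?_) fun c => ?_
  · rw [Projectivization.mk_eq_mk_iff_crossProduct_eq_zero] at hcd
    have h : (d - c) • crossProduct l₁.rep l₂.rep = 0 := by
      rw [← hcd]
      simp only [map_add, map_smul, LinearMap.add_apply, LinearMap.smul_apply, cross_self,
        smul_zero, add_zero, zero_add]
      rw [← cross_anticomm l₁.rep l₂.rep, sub_smul, smul_neg, sub_eq_add_neg, add_comm]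
    rcases smul_eq_zero.1 h with h | h
    · exact (sub_eq_zero.1 h).symm
    · rw [← Projectivization.mk_eq_mk_iff_crossProduct_eq_zero l₁.rep_nonzero l₂.rep_nonzero,
        l₁.mk_rep, l₂.mk_rep] at h
      exact absurd h h₁₂
  · rw [Set.mem_ofPred_eq, ← O.mk_rep, mk_mem_mk O.rep_nonzero, add_dotProduct, smul_dotProduct,
      mem_iff_dotProduct.1 h₁, mem_iff_dotProduct.1 h₂, smul_zero, add_zero]

lemma exists_isSupersolvableResolution {A K : Set Line} (hA : A.Finite) (hK : K.Finite)
    (hd : Disjoint A K) {k : ℕ} (hk : K.ncard = k) (hs : IsSupersolvable (A ∪ K)) :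
    ∃ Y : Fin (k + 1) → Set Line, IsSupersolvableResolution A k Y ∧ Y (Fin.last k) = A ∪ K := by
  subst hk
  have : Fintype K := hK.fintype
  have hcard : Fintype.card K = K.ncard := by
    rw [← Nat.card_eq_fintype_card, Nat.card_coe_set_eq]
  let e : K ≃ Fin K.ncard := Fintype.equivFinOfCardEq hcard
  let B : ℕ → Set Line := fun i => (fun x : K => x.1) '' {x | (e x : ℕ) < i}
  have hBK : ∀ i, B i ⊆ K := by
    rintro i _ ⟨x, -, rfl⟩
    exact x.2
  have hlast : B K.ncard = K := Set.Subset.antisymm (hBK _) fun x hx =>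
    ⟨⟨x, hx⟩, (e ⟨x, hx⟩).isLt, rfl⟩
  have hBcard : ∀ i ≤ K.ncard, (B i).ncard = i := fun i hi => by
    rw [Set.ncard_image_of_injective _ Subtype.val_injective]
    have : {x | (e x : ℕ) < i} = e.symm '' {j | (j : ℕ) < i} := by
      ext x
      simp
    rw [this, Set.ncard_image_of_injective _ e.symm.injective, Set.ncard_eq_toFinset_card']
    have : ({j : Fin K.ncard | (j : ℕ) < i} : Set _).toFinset =
        Finset.univ.filter (fun j : Fin K.ncard => (j : ℕ) < i) := by
      ext; simp
    rw [this, Fin.card_filter_val_lt, min_eq_right hi]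
  refine ⟨fun i => A ∪ B i, ⟨?_, ?_, fun i => ⟨?_, ?_⟩, ?_⟩, ?_⟩
  · simp [B]
  · rintro i j hij l (h | ⟨x, hx, rfl⟩)
    · exact Or.inl h
    · exact Or.inr ⟨x, lt_of_lt_of_le (show (e x : ℕ) < i from hx) (Fin.le_def.1 hij), rfl⟩
  · exact hA.union (hK.subset (hBK i))
  · rw [ncard_union_of_disjoint hA (hK.subset (hBK i)) (hd.mono_right (hBK i)),
      hBcard i (Nat.lt_succ_iff.1 i.isLt)]
  · simpa [hlast] using hs
  · simp [hlast]

/-! ### The ring `ℤ[ω, μ₁]` -/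

/-- The element `a + b μ₁ + c ω + d μ₁ ω` of the ring `ℤ[ω, μ₁]`. -/
structure WInt where
  a : ℤ
  b : ℤ
  c : ℤ
  d : ℤ

namespace WInt

/-- The sum in `ℤ[ω, μ₁]`. -/
def add (x y : WInt) : WInt :=
  ⟨Int.add x.a y.a, Int.add x.b y.b, Int.add x.c y.c, Int.add x.d y.d⟩

/-- The negative in `ℤ[ω, μ₁]`. -/
def neg (x : WInt) : WInt := ⟨Int.neg x.a, Int.neg x.b, Int.neg x.c, Int.neg x.d⟩

/-- The difference in `ℤ[ω, μ₁]`. -/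
def sub (x y : WInt) : WInt := x.add y.neg

/-- The product by an integer. -/
def smul (n : ℤ) (x : WInt) : WInt := ⟨Int.mul n x.a, Int.mul n x.b, Int.mul n x.c, Int.mul n x.d⟩

/-- The product by `μ₁`, where `μ₁ ^ 2 = 1 - μ₁`. -/
def mulMu (x : WInt) : WInt := ⟨x.b, Int.add x.a (Int.neg x.b), x.d, Int.add x.c (Int.neg x.d)⟩

/-- The product by `ω`, where `ω ^ 2 = -1 - ω`. -/
def mulOmega (x : WInt) : WInt :=
  ⟨Int.neg x.c, Int.neg x.d, Int.add x.a (Int.neg x.c), Int.add x.b (Int.neg x.d)⟩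

/-- The product in `ℤ[ω, μ₁]`. -/
def mul (x y : WInt) : WInt :=
  match x with
  | ⟨a, b, c, d⟩ => (((smul c y).add (smul d y.mulMu)).mulOmega).add
      ((smul a y).add (smul b y.mulMu))

/-- The test for zero. -/
def isZero (x : WInt) : Bool := match x with
  | ⟨.ofNat 0, .ofNat 0, .ofNat 0, .ofNat 0⟩ => true
  | _ => false

end WInt

/-- Vectors over `ℤ[ω, μ₁]`. -/
structure WVec where
  x : WInt
  y : WInt
  z : WInt

namespace WVec

/-- The dot product. -/
def dot (u v : WVec) : WInt := ((u.x.mul v.x).add (u.y.mul v.y)).add (u.z.mul v.z)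

/-- The cross product. -/
def cross (u v : WVec) : WVec :=
  ⟨(u.y.mul v.z).sub (u.z.mul v.y), (u.z.mul v.x).sub (u.x.mul v.z),
    (u.x.mul v.y).sub (u.y.mul v.x)⟩

/-- The test for zero. -/
def isZero (u : WVec) : Bool := u.x.isZero && u.y.isZero && u.z.isZero

/-- The action of the matrix with rows `u`, `v`, `w`. -/
def mulVec (M : WVec × WVec × WVec) (v : WVec) : WVec := ⟨M.1.dot v, M.2.1.dot v, M.2.2.dot v⟩

/-- The transpose of the matrix with rows `u`, `v`, `w`. -/
def transpose (M : WVec × WVec × WVec) : WVec × WVec × WVec :=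
  ⟨⟨M.1.x, M.2.1.x, M.2.2.x⟩, ⟨M.1.y, M.2.1.y, M.2.2.y⟩, ⟨M.1.z, M.2.1.z, M.2.2.z⟩⟩

end WVec

/-! ### The lines and points of the Wiman arrangement -/

/-- Coefficients of the lines of the Wiman arrangement. -/
def wimanLines : List WVec :=
  [⟨⟨1,0,0,0⟩,⟨0,0,0,0⟩,⟨0,0,0,0⟩⟩,
   ⟨⟨0,0,0,0⟩,⟨-1,0,0,0⟩,⟨0,0,0,0⟩⟩,
   ⟨⟨-1,0,0,0⟩,⟨-1,-1,0,0⟩,⟨0,1,0,0⟩⟩,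
   ⟨⟨0,0,0,0⟩,⟨0,0,0,0⟩,⟨-1,0,0,0⟩⟩,
   ⟨⟨-1,-1,0,0⟩,⟨0,1,0,0⟩,⟨-1,0,0,0⟩⟩,
   ⟨⟨-1,1,0,0⟩,⟨0,1,0,0⟩,⟨1,0,0,0⟩⟩,
   ⟨⟨-1,0,0,0⟩,⟨1,1,0,0⟩,⟨0,-1,0,0⟩⟩,
   ⟨⟨-1,0,-1,0⟩,⟨0,-1,0,0⟩,⟨0,0,1,1⟩⟩,
   ⟨⟨-1,-1,0,0⟩,⟨0,-1,0,0⟩,⟨1,0,0,0⟩⟩,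
   ⟨⟨-1,-1,0,0⟩,⟨0,0,-1,0⟩,⟨0,-1,0,-1⟩⟩,
   ⟨⟨-1,1,0,0⟩,⟨0,-1,0,0⟩,⟨-1,0,0,0⟩⟩,
   ⟨⟨-1,1,0,0⟩,⟨0,0,1,0⟩,⟨0,-1,0,-1⟩⟩,
   ⟨⟨-1,1,0,0⟩,⟨0,-1,0,0⟩,⟨1,0,0,0⟩⟩,
   ⟨⟨-1,0,-1,0⟩,⟨0,1,0,0⟩,⟨0,0,-1,-1⟩⟩,
   ⟨⟨-1,0,0,0⟩,⟨1,1,0,0⟩,⟨0,1,0,0⟩⟩,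
   ⟨⟨-1,-1,0,0⟩,⟨0,0,1,0⟩,⟨0,1,0,1⟩⟩,
   ⟨⟨-1,-1,0,0⟩,⟨0,-1,0,0⟩,⟨-1,0,0,0⟩⟩,
   ⟨⟨-1,1,0,0⟩,⟨0,0,-1,0⟩,⟨0,1,0,1⟩⟩,
   ⟨⟨-1,-1,0,0⟩,⟨0,1,0,0⟩,⟨1,0,0,0⟩⟩,
   ⟨⟨-1,1,0,0⟩,⟨0,1,0,0⟩,⟨-1,0,0,0⟩⟩,
   ⟨⟨-1,1,0,0⟩,⟨0,0,1,0⟩,⟨0,1,0,1⟩⟩,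
   ⟨⟨-1,-1,0,0⟩,⟨0,0,1,0⟩,⟨0,-1,0,-1⟩⟩,
   ⟨⟨0,0,0,0⟩,⟨-1,0,-1,-1⟩,⟨0,1,-1,0⟩⟩,
   ⟨⟨-1,0,0,0⟩,⟨-1,-1,0,0⟩,⟨0,-1,0,0⟩⟩,
   ⟨⟨-1,0,-1,0⟩,⟨0,-1,0,0⟩,⟨0,0,-1,-1⟩⟩,
   ⟨⟨-1,1,0,0⟩,⟨0,0,-1,0⟩,⟨0,-1,0,-1⟩⟩,
   ⟨⟨-1,0,0,-1⟩,⟨0,-1,0,-1⟩,⟨0,0,0,1⟩⟩,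
   ⟨⟨-1,-1,0,0⟩,⟨0,0,-1,0⟩,⟨0,1,0,1⟩⟩,
   ⟨⟨-1,0,-1,0⟩,⟨0,1,0,0⟩,⟨0,0,1,1⟩⟩,
   ⟨⟨-1,0,0,-1⟩,⟨0,1,0,1⟩,⟨0,0,0,-1⟩⟩,
   ⟨⟨-1,-1,0,-1⟩,⟨0,0,0,0⟩,⟨0,-1,1,0⟩⟩,
   ⟨⟨-1,0,-1,-1⟩,⟨0,1,-1,0⟩,⟨0,0,0,0⟩⟩,
   ⟨⟨-1,0,-1,0⟩,⟨1,0,0,-1⟩,⟨1,0,0,0⟩⟩,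
   ⟨⟨-1,0,0,0⟩,⟨1,0,1,0⟩,⟨-1,0,0,1⟩⟩,
   ⟨⟨-1,0,-1,0⟩,⟨-1,0,0,1⟩,⟨1,0,0,0⟩⟩,
   ⟨⟨-1,0,0,0⟩,⟨1,0,1,0⟩,⟨1,0,0,-1⟩⟩,
   ⟨⟨-1,-1,0,-1⟩,⟨0,0,0,0⟩,⟨0,1,-1,0⟩⟩,
   ⟨⟨-1,0,-1,-1⟩,⟨0,-1,1,0⟩,⟨0,0,0,0⟩⟩,
   ⟨⟨-1,0,-1,0⟩,⟨-1,0,0,1⟩,⟨-1,0,0,0⟩⟩,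
   ⟨⟨-1,0,0,0⟩,⟨-1,0,-1,0⟩,⟨1,0,0,-1⟩⟩,
   ⟨⟨-1,0,-1,0⟩,⟨1,0,0,-1⟩,⟨-1,0,0,0⟩⟩,
   ⟨⟨-1,0,0,0⟩,⟨-1,0,-1,0⟩,⟨-1,0,0,1⟩⟩,
   ⟨⟨0,0,0,0⟩,⟨-1,0,-1,-1⟩,⟨0,-1,1,0⟩⟩,
   ⟨⟨-1,0,0,-1⟩,⟨0,1,0,1⟩,⟨0,0,0,1⟩⟩,
   ⟨⟨-1,0,0,-1⟩,⟨0,-1,0,-1⟩,⟨0,0,0,-1⟩⟩]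

/-- The sets of lines through the singular points of the Wiman arrangement. -/
def wimanBlocks : List (List ℕ) :=
  [[0,4,8,12,19], [3,5,6,14,19], [1,2,8,14,18], [0,9,15,20,25], [2,3,10,12,23], [1,11,13,24,25],
   [1,4,6,16,23], [3,7,15,21,24], [2,11,26,30,33], [0,5,10,16,18], [1,7,17,20,28],
   [4,9,22,32,33], [3,9,13,27,28], [5,7,26,31,32], [6,17,29,36,39], [0,11,17,21,27],
   [4,7,29,30,35], [8,15,22,38,39], [5,11,22,34,35], [10,13,29,37,38], [18,27,35,40,42],
   [2,9,29,31,34], [8,13,26,36,41], [19,24,31,40,44], [10,17,22,40,41], [20,23,35,36,44],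
   [12,28,34,37,43], [16,21,34,41,42], [6,15,26,37,40], [19,20,33,38,42], [14,25,30,41,43],
   [14,21,32,37,44], [23,27,31,38,43], [16,28,30,39,44], [18,24,33,36,43], [12,25,32,39,42],
   [0,1,31,37], [0,3,30,36], [0,22,43,44], [0,26,29,42], [1,3,22,42], [1,30,38,40],
   [1,32,34,36], [2,4,21,40], [2,5,20,39], [2,13,42,44], [2,15,17,43], [3,31,39,41],
   [3,33,35,37], [4,5,13,43], [4,20,37,41], [4,24,27,39], [5,21,36,38], [5,25,28,40],
   [6,7,42,43], [6,8,27,34], [6,9,11,44], [6,10,25,33], [7,8,10,44], [7,9,18,41], [7,11,12,38],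
   [8,21,28,33], [8,25,31,35], [9,12,36,40], [9,14,16,38], [10,20,24,34], [10,27,30,32],
   [11,18,37,39], [11,19,23,41], [12,14,17,35], [12,16,24,26], [13,15,16,35], [13,17,19,32],
   [14,20,26,27], [14,22,24,29], [15,18,23,32], [15,19,30,34], [16,17,31,33], [18,19,28,29],
   [21,23,25,29], [22,23,26,28], [0,2,6], [0,7,13], [0,14,23], [0,24,28], [0,32,38], [0,33,39],
   [0,34,40], [0,35,41], [1,5,12], [1,9,21], [1,10,19], [1,15,27], [1,26,43], [1,29,44],
   [1,33,41], [1,35,39], [2,7,22], [2,16,19], [2,24,41], [2,25,36], [2,27,37], [2,28,38],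
   [2,32,35], [3,4,18], [3,8,16], [3,11,20], [3,17,25], [3,26,44], [3,29,43], [3,32,40],
   [3,34,38], [4,10,14], [4,11,31], [4,15,42], [4,17,44], [4,25,38], [4,26,34], [4,28,36],
   [5,8,23], [5,9,30], [5,15,44], [5,17,42], [5,24,37], [5,27,41], [5,29,33], [6,12,18],
   [6,13,22], [6,20,30], [6,21,31], [6,24,32], [6,28,35], [6,38,41], [7,14,40], [7,16,36],
   [7,19,37], [7,23,39], [7,25,27], [7,33,34], [8,9,42], [8,11,43], [8,17,37], [8,20,32],
   [8,24,30], [8,29,40], [9,10,43], [9,17,24], [9,19,39], [9,23,37], [9,26,35], [10,11,42],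
   [10,15,36], [10,21,35], [10,26,39], [10,28,31], [11,14,36], [11,15,28], [11,16,40],
   [11,29,32], [12,13,31], [12,15,33], [12,20,22], [12,21,30], [12,27,29], [12,41,44],
   [13,14,33], [13,18,30], [13,20,21], [13,23,34], [13,39,40], [14,15,31], [14,28,42],
   [14,34,39], [15,29,41], [16,20,29], [16,22,27], [16,25,37], [16,32,43], [17,18,34],
   [17,23,30], [17,26,38], [18,20,31], [18,21,22], [18,25,26], [18,38,44], [19,21,26],
   [19,22,25], [19,27,36], [19,35,43], [20,40,43], [21,39,43], [22,30,31], [22,36,37],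
   [23,24,42], [23,33,40], [24,35,38], [25,34,44], [27,33,44], [28,32,41], [30,37,42],
   [31,36,42]]

/-- The coefficients of the line with a given index. -/
def lineVec (i : ℕ) : WVec := wimanLines.getD i ⟨⟨0, 0, 0, 0⟩, ⟨0, 0, 0, 0⟩, ⟨0, 0, 0, 0⟩⟩

/-- The coordinates of the singular point with a given set of lines. -/
def ptVec (B : List ℕ) : WVec := (lineVec (B.getD 0 0)).cross (lineVec (B.getD 1 0))

/-- Integral multiples of Wiman's generators. -/
def wimanMatrices : List (WVec × WVec × WVec) :=
  [⟨⟨⟨0,0,0,0⟩,⟨1,0,0,0⟩,⟨0,0,0,0⟩⟩,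
     ⟨⟨0,0,0,0⟩,⟨0,0,0,0⟩,⟨1,0,0,0⟩⟩,
     ⟨⟨1,0,0,0⟩,⟨0,0,0,0⟩,⟨0,0,0,0⟩⟩⟩,
   ⟨⟨⟨1,0,0,0⟩,⟨0,0,0,0⟩,⟨0,0,0,0⟩⟩,
     ⟨⟨0,0,0,0⟩,⟨-1,0,0,0⟩,⟨0,0,0,0⟩⟩,
     ⟨⟨0,0,0,0⟩,⟨0,0,0,0⟩,⟨-1,0,0,0⟩⟩⟩,
   ⟨⟨⟨-1,0,0,0⟩,⟨-1,-1,0,0⟩,⟨0,1,0,0⟩⟩,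
     ⟨⟨-1,-1,0,0⟩,⟨0,1,0,0⟩,⟨-1,0,0,0⟩⟩,
     ⟨⟨0,1,0,0⟩,⟨-1,0,0,0⟩,⟨-1,-1,0,0⟩⟩⟩,
   ⟨⟨⟨-1,0,0,0⟩,⟨0,0,0,0⟩,⟨0,0,0,0⟩⟩,
     ⟨⟨0,0,0,0⟩,⟨0,0,0,0⟩,⟨1,0,1,0⟩⟩,
     ⟨⟨0,0,0,0⟩,⟨0,0,-1,0⟩,⟨0,0,0,0⟩⟩⟩]

/-- Whether all elements of the second list are reached, in order, from earlier elements. -/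
def reaches {α : Type*} (r : α → α → Bool) : List α → List α → Bool
  | _, [] => true
  | s, x :: xs => s.any (r · x) && reaches r (x :: s) xs

/-! ### Finite checks on the tables in exact arithmetic. -/

lemma lineVec_ne_zero : (List.range 45).all (fun i => !(lineVec i).isZero) = true := by
  decide +kernel

lemma ptVec_ne_zero : wimanBlocks.all (fun B => !(ptVec B).isZero) = true := by
  decide +kernel

lemma incidence_table : wimanBlocks.all (fun B => (List.range 45).all fun i =>
    ((lineVec i).dot (ptVec B)).isZero == B.contains i) = true := by
  decide +kernel

/-- Completeness of the table: with the incidences, no intersection of two lines is missing. -/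
lemma exists_block_of_pair : (List.range 45).all (fun i => (List.range i).all fun j =>
    (wimanBlocks.filter (·.contains i)).any fun B => B.contains j) = true := by
  decide +kernel

/-- Used to see that the 45 listed lines are distinct. -/
lemma exists_block_separating : (List.range 45).all (fun i => (List.range 45).all fun j =>
    i == j || wimanBlocks.any fun B => B.contains i && !B.contains j) = true := by
  decide +kernel

/-- A strictly increasing list is determined by its set of members, so distinct blocks give distinct
points. -/
lemma blocks_sorted : wimanBlocks.all (fun B => B.all (· < 45) && decide (B.Pairwise (· < ·))) := by
  decide +kernel

lemma blocks_nodup : wimanBlocks.Nodup := by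
  decide +kernel

lemma blocks_length : wimanBlocks.all (fun B => 2 ≤ B.length) ∧
    (wimanBlocks.filter (·.length == 3)).length = 120 ∧
    (wimanBlocks.filter (·.length == 4)).length = 45 ∧
    (wimanBlocks.filter (·.length == 5)).length = 36 := by
  decide +kernel

/-- Lines pull back by row vectors, hence the transpose; a zero cross product expresses
proportionality. -/
lemma lines_closed : wimanMatrices.all (fun M => (List.range 45).all fun i =>
    (List.range 45).any fun j =>
      ((WVec.mulVec (WVec.transpose M) (lineVec i)).cross (lineVec j)).isZero) = true := by
  decide +kernel

lemma lines_reached : reaches (fun i j => wimanMatrices.any fun M =>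
    ((WVec.mulVec (WVec.transpose M) (lineVec i)).cross (lineVec j)).isZero) [0]
    (List.range' 1 44) = true := by
  decide +kernel

/-- The sets of lines through the quintuple points. -/
def quintBlocks : List (List ℕ) := wimanBlocks.filter (·.length == 5)

/-- A quintuple point. -/
def quint₀ : List ℕ := wimanBlocks.headD []

lemma quint_reached : reaches (fun B B' => wimanMatrices.any fun M =>
    ((WVec.mulVec M (ptVec B)).cross (ptVec B')).isZero) [quint₀] quintBlocks.tail = true := by
  decide +kernel

/-- The sets of lines through the points that lie on no line through `quint₀`. -/
def remBlocks : List (List ℕ) := wimanBlocks.filter fun B => B.all fun i => !quint₀.contains i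

/-- Two points are not collinear with `quint₀`. -/
def JoinNe (B B' : List ℕ) : Prop :=
  (((ptVec quint₀).cross (ptVec B)).dot (ptVec B')).isZero = false

instance : DecidableRel JoinNe := fun B B' =>
  inferInstanceAs (Decidable ((((ptVec quint₀).cross (ptVec B)).dot (ptVec B')).isZero = false))

/-- Representatives of the lines joining `quint₀` to the remaining points. -/
def joinBlocks : List (List ℕ) := remBlocks.pwFilter JoinNe

/-- By transitivity on lines each line carries 4 quintuple, 4 quadruple and 8 triple points, so the
count is `201 - (1 + 5 * 15)`. -/
lemma remBlocks_length : remBlocks.length = 125 := by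
  decide +kernel

lemma joinBlocks_length : joinBlocks.length = 85 := by
  decide +kernel

/-! ### Interpretation over the complex numbers -/

lemma mu₁_sq : mu₁ ^ 2 = 1 - mu₁ := by
  have h : ((Real.sqrt 5 : ℝ) : ℂ) ^ 2 = 5 := by
    rw [← Complex.ofReal_pow, Real.sq_sqrt (by norm_num)]
    norm_num
  rw [mu₁]
  linear_combination h / 4

lemma omega_sq : omega ^ 2 = -1 - omega := by
  have h : ((Real.sqrt 3 : ℝ) : ℂ) ^ 2 = 3 := by
    rw [← Complex.ofReal_pow, Real.sq_sqrt (by norm_num)]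
    norm_num
  rw [omega]
  linear_combination (Complex.I ^ 2) * h / 4 + 3 * Complex.I_sq / 4

lemma mu₂_eq : mu₂ = -1 - mu₁ := by
  rw [mu₁, mu₂]
  ring

lemma eq_zero_of_add_mul_sqrt_five {a b : ℤ} (h : (a : ℝ) + b * Real.sqrt 5 = 0) :
    a = 0 ∧ b = 0 := by
  have hb : b = 0 := by
    by_contra hb
    have hirr : Irrational (Real.sqrt 5) := by
      simpa using Nat.Prime.irrational_sqrt (p := 5) (by norm_num)
    exact (hirr.intCast_mul hb).ne_int (-a) (by push_cast; linarith)
  subst hb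
  simpa using h

namespace WInt

/-- The value in `ℂ`. -/
def toC (x : WInt) : ℂ := x.a + x.b * mu₁ + (x.c + x.d * mu₁) * omega

lemma toC_add (x y : WInt) : (x.add y).toC = x.toC + y.toC := by
  simp only [toC, add, Int.add_def, Int.cast_add]
  ring

lemma toC_neg (x : WInt) : x.neg.toC = -x.toC := by
  have h : ∀ n : ℤ, Int.neg n = -n := fun _ => rfl
  simp only [toC, neg, h, Int.cast_neg]
  ring

lemma toC_sub (x y : WInt) : (x.sub y).toC = x.toC - y.toC := by
  rw [sub, toC_add, toC_neg, sub_eq_add_neg]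

lemma toC_smul (n : ℤ) (x : WInt) : (smul n x).toC = n * x.toC := by
  simp only [toC, smul, Int.mul_def, Int.cast_mul]
  ring

lemma toC_mulMu (x : WInt) : x.mulMu.toC = mu₁ * x.toC := by
  have h : ∀ n : ℤ, Int.neg n = -n := fun _ => rfl
  simp only [toC, mulMu, h, Int.add_def, Int.cast_add, Int.cast_neg]
  linear_combination -(x.b + x.d * omega) * mu₁_sq

lemma toC_mulOmega (x : WInt) : x.mulOmega.toC = omega * x.toC := by
  have h : ∀ n : ℤ, Int.neg n = -n := fun _ => rfl
  simp only [toC, mulOmega, h, Int.add_def, Int.cast_add, Int.cast_neg]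
  linear_combination -(x.c + x.d * mu₁) * omega_sq

lemma toC_mul (x y : WInt) : (x.mul y).toC = x.toC * y.toC := by
  obtain ⟨a, b, c, d⟩ := x
  simp only [mul, toC_add, toC_mulOmega, toC_smul, toC_mulMu]
  simp only [toC]
  ring

/-- The numbers `1, μ₁, ω, μ₁ω` are independent over `ℚ`: the imaginary part isolates `c + d μ₁`,
then the real part `a + b μ₁`, and `√5` is irrational. Hence the tests on the tables decide equality
in `ℂ`. -/
lemma isZero_iff {x : WInt} : x.isZero = true ↔ x.toC = 0 := by
  have h0 : x.isZero = true ↔ x.a = 0 ∧ x.b = 0 ∧ x.c = 0 ∧ x.d = 0 := by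
    unfold isZero
    split
    · simp
    · rename_i h
      refine ⟨fun h => absurd h (by simp), fun ⟨h1, h2, h3, h4⟩ => (h ?_).elim⟩
      obtain ⟨a, b, c, d⟩ := x
      simp_all
  rw [h0]
  constructor
  · rintro ⟨h1, h2, h3, h4⟩
    simp [toC, h1, h2, h3, h4]
  · intro h
    have hmu : mu₁ = (((-1 + Real.sqrt 5) / 2 : ℝ) : ℂ) := by
      rw [mu₁]; push_cast; ring
    have hom : omega = ((-1 / 2 : ℝ) : ℂ) + ((Real.sqrt 3 / 2 : ℝ) : ℂ) * Complex.I := by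
      rw [omega]; push_cast; ring
    set m : ℝ := (-1 + Real.sqrt 5) / 2 with hm
    have hx : x.toC = ((x.a + x.b * m + (x.c + x.d * m) * (-1 / 2) : ℝ) : ℂ) +
        (((x.c + x.d * m) * (Real.sqrt 3 / 2) : ℝ) : ℂ) * Complex.I := by
      rw [toC, hmu, hom]; push_cast; ring
    rw [hx] at h
    rw [← Complex.mk_eq_add_mul_I, Complex.ext_iff] at h
    obtain ⟨hre, him⟩ := h
    simp only [Complex.zero_re, Complex.zero_im] at hre him
    have hcd : x.c + x.d * m = 0 := (mul_eq_zero.1 him).resolve_right (by positivity)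
    rw [hcd, zero_mul, add_zero] at hre
    have key : ∀ a b : ℤ, (a : ℝ) + b * m = 0 → a = 0 ∧ b = 0 := fun a b hab => by
      -- Twice `a + b m` is `(2a - b) + b √5`.
      have h2 := eq_zero_of_add_mul_sqrt_five (a := 2 * a - b) (b := b) (by
        push_cast
        rw [hm] at hab
        linarith)
      omega
    obtain ⟨h1, h2⟩ := key _ _ hre
    obtain ⟨h3, h4⟩ := key _ _ hcd
    exact ⟨h1, h2, h3, h4⟩

end WInt

namespace WVec

/-- The value in `ℂ ^ 3`. -/
def toC (v : WVec) : Fin 3 → ℂ := ![v.x.toC, v.y.toC, v.z.toC]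

lemma toC_dot (u v : WVec) : (u.dot v).toC = u.toC ⬝ᵥ v.toC := by
  simp [dot, toC, WInt.toC_add, WInt.toC_mul, add_assoc]

lemma toC_cross (u v : WVec) : (u.cross v).toC = crossProduct u.toC v.toC := by
  simp [cross, toC, WInt.toC_sub, WInt.toC_mul, cross_apply]

lemma isZero_iff {v : WVec} : v.isZero = true ↔ v.toC = 0 := by
  simp [isZero, toC, WInt.isZero_iff, and_assoc]

/-- The complex matrix with given rows. -/
def toMat (M : WVec × WVec × WVec) : Matrix (Fin 3) (Fin 3) ℂ :=
  Matrix.of ![M.1.toC, M.2.1.toC, M.2.2.toC]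

lemma toC_mulVec (M : WVec × WVec × WVec) (v : WVec) : (mulVec M v).toC = toMat M *ᵥ v.toC := by
  ext i
  fin_cases i <;> simp [mulVec, toMat, toC, WInt.toC_add, WInt.toC_mul, dot,
    Matrix.mulVec, add_assoc]

lemma toC_mulVec_transpose (M : WVec × WVec × WVec) (v : WVec) :
    (mulVec (transpose M) v).toC = v.toC ᵥ* toMat M := by
  rw [toC_mulVec, ← Matrix.mulVec_transpose]
  congr 1
  ext i j
  fin_cases i <;> fin_cases j <;> simp [toMat, transpose, toC]

end WVec

/-! ### Points and lines with given coordinates -/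

/-- The element of the projective plane with given nonzero coordinates. -/
def proj (v : Fin 3 → ℂ) : ℙ ℂ (Fin 3 → ℂ) :=
  if h : v ≠ 0 then Projectivization.mk ℂ v h else lineX

lemma proj_eq_mk {v : Fin 3 → ℂ} (h : v ≠ 0) : proj v = Projectivization.mk ℂ v h := dif_pos h

lemma proj_rep (P : ℙ ℂ (Fin 3 → ℂ)) : proj P.rep = P := by
  rw [proj_eq_mk P.rep_nonzero, P.mk_rep]

lemma proj_mem_proj {u v : Fin 3 → ℂ} (hu : u ≠ 0) (hv : v ≠ 0) :
    (proj u : Point) ∈ (proj v : Line) ↔ v ⬝ᵥ u = 0 := by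
  rw [proj_eq_mk hu, proj_eq_mk hv, mk_mem_mk]

lemma proj_eq_proj {u v : Fin 3 → ℂ} (hu : u ≠ 0) (hv : v ≠ 0) :
    proj u = proj v ↔ crossProduct u v = 0 := by
  rw [proj_eq_mk hu, proj_eq_mk hv, Projectivization.mk_eq_mk_iff_crossProduct_eq_zero]

lemma proj_smul {c : ℂ} (hc : c ≠ 0) (v : Fin 3 → ℂ) : proj (c • v) = proj v := by
  by_cases hv : v = 0
  · rw [hv, smul_zero]
  rw [proj_eq_proj (smul_ne_zero hc hv) hv, map_smul, LinearMap.smul_apply, cross_self, smul_zero]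

lemma mem_proj {P : Point} {v : Fin 3 → ℂ} (hv : v ≠ 0) :
    P ∈ (proj v : Line) ↔ v ⬝ᵥ P.rep = 0 := by
  conv_lhs => rw [← proj_rep P]
  exact proj_mem_proj P.rep_nonzero hv

lemma smul_proj (g : GL (Fin 3) ℂ) {v : Fin 3 → ℂ} (hv : v ≠ 0) :
    g • (proj v : Point) = proj ((g : Matrix (Fin 3) (Fin 3) ℂ) *ᵥ v) := by
  have h : (g : Matrix (Fin 3) (Fin 3) ℂ) *ᵥ v ≠ 0 := (smul_ne_zero_iff_ne g).2 hv
  rw [proj_eq_mk hv, proj_eq_mk h, Projectivization.smul_mk]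
  rfl

lemma vecMul_ne_zero (g : GL (Fin 3) ℂ) {v : Fin 3 → ℂ} (hv : v ≠ 0) :
    v ᵥ* (g : Matrix (Fin 3) (Fin 3) ℂ) ≠ 0 := fun h => hv (by
  have := congrArg (· ᵥ* ((g⁻¹ : GL (Fin 3) ℂ) : Matrix (Fin 3) (Fin 3) ℂ)) h
  simpa only [Matrix.vecMul_vecMul, Units.mul_inv, Matrix.vecMul_one, Matrix.zero_vecMul]
    using this)

lemma mem_proj_vecMul (g : GL (Fin 3) ℂ) {v : Fin 3 → ℂ} (hv : v ≠ 0) {P : Point} :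
    P ∈ (proj (v ᵥ* (g : Matrix (Fin 3) (Fin 3) ℂ)) : Line) ↔ g • P ∈ (proj v : Line) := by
  have h : (g : Matrix (Fin 3) (Fin 3) ℂ) *ᵥ P.rep ≠ 0 := (smul_ne_zero_iff_ne g).2 P.rep_nonzero
  rw [mem_proj (vecMul_ne_zero g hv)]
  conv_rhs => rw [← proj_rep P, smul_proj g P.rep_nonzero, proj_mem_proj h hv]
  rw [Matrix.dotProduct_mulVec]

/-- The line whose points are carried to `l` by `g`. -/
def pullback (g : GL (Fin 3) ℂ) (l : Line) : Line :=
  proj (l.rep ᵥ* (g : Matrix (Fin 3) (Fin 3) ℂ))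

lemma mem_pullback {g : GL (Fin 3) ℂ} {l : Line} {P : Point} : P ∈ pullback g l ↔ g • P ∈ l := by
  rw [pullback, mem_proj_vecMul g l.rep_nonzero, proj_rep]

lemma line_ext {l m : Line} (h : ∀ P : Point, P ∈ l ↔ P ∈ m) : l = m :=
  eq_of_pts_subset fun P hP => (h P).1 hP

lemma pullback_proj (g : GL (Fin 3) ℂ) {v : Fin 3 → ℂ} (hv : v ≠ 0) :
    pullback g (proj v) = proj (v ᵥ* (g : Matrix (Fin 3) (Fin 3) ℂ)) :=
  line_ext fun P => by rw [mem_pullback, mem_proj_vecMul g hv]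

lemma pullback_one (l : Line) : pullback 1 l = l :=
  line_ext fun P => by rw [mem_pullback, one_smul]

/-- Pulling back is a right action, whence the reversed order. -/
lemma pullback_mul (g h : GL (Fin 3) ℂ) (l : Line) :
    pullback (g * h) l = pullback h (pullback g l) :=
  line_ext fun P => by rw [mem_pullback, mem_pullback, mem_pullback, mul_smul]

lemma mem_wiman {l : Line} : l ∈ wiman ↔ ∃ g ∈ valentinerGroup, l = pullback g lineX := by
  constructor
  · rintro ⟨g, hg, h⟩
    exact ⟨g, hg, line_ext fun P => by rw [h, mem_pullback]⟩
  · rintro ⟨g, hg, rfl⟩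
    exact ⟨g, hg, fun P => mem_pullback⟩

lemma pullback_mem_wiman {g : GL (Fin 3) ℂ} (hg : g ∈ valentinerGroup) {l : Line} :
    pullback g l ∈ wiman ↔ l ∈ wiman := by
  rw [mem_wiman, mem_wiman]
  constructor
  · rintro ⟨h, hh, e⟩
    refine ⟨h * g⁻¹, mul_mem hh (inv_mem hg), ?_⟩
    rw [pullback_mul, ← e, ← pullback_mul, mul_inv_cancel, pullback_one]
  · rintro ⟨h, hh, rfl⟩
    exact ⟨h * g, mul_mem hh hg, (pullback_mul h g _).symm⟩

/-! ### Generators -/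

/-- Ensures that every listed generator is the matrix of an actual element of the group. -/
lemma det_wimanGenerators {A : Matrix (Fin 3) (Fin 3) ℂ} (hA : A ∈ wimanGenerators) :
    A.det ≠ 0 := by
  have h : A.det = 1 := by
    rcases hA with rfl | rfl | rfl | rfl
    · simp [Matrix.det_fin_three]
    · simp [Matrix.det_fin_three]
    · simp only [Matrix.det_fin_three, mu₂_eq]
      simp
      linear_combination (3 / 4) * mu₁_sq
    · simp [Matrix.det_fin_three]
      linear_combination (omega - 1) * omega_sq
  simp [h]

/-- The integral matrices agree with the generators up to a nonzero scalar, which is invisible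
projectively; only the third needs one, the factor 2 clearing its denominator. -/
lemma wimanMatrices_spec :
    (∀ M ∈ wimanMatrices, ∃ A ∈ wimanGenerators, ∃ c : ℂ, c ≠ 0 ∧ WVec.toMat M = c • A) ∧
    ∀ A ∈ wimanGenerators, ∃ M ∈ wimanMatrices, ∃ c : ℂ, c ≠ 0 ∧ WVec.toMat M = c • A := by
  have h₀ : WVec.toMat wimanMatrices[0] = (1 : ℂ) • !![0, 1, 0; 0, 0, 1; 1, 0, 0] := by
    ext i j
    fin_cases i <;> fin_cases j <;> simp [wimanMatrices, WVec.toMat, WVec.toC, WInt.toC]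
  have h₁ : WVec.toMat wimanMatrices[1] = (1 : ℂ) • !![1, 0, 0; 0, -1, 0; 0, 0, -1] := by
    ext i j
    fin_cases i <;> fin_cases j <;> simp [wimanMatrices, WVec.toMat, WVec.toC, WInt.toC]
  have h₂ : WVec.toMat wimanMatrices[2] =
      (2 : ℂ) • ((1 / 2 : ℂ) • !![-1, mu₂, mu₁; mu₂, mu₁, -1; mu₁, -1, mu₂]) := by
    ext i j
    fin_cases i <;> fin_cases j <;>
      simp [wimanMatrices, WVec.toMat, WVec.toC, WInt.toC, mu₂_eq] <;> ring
  have h₃ : WVec.toMat wimanMatrices[3] =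
      (1 : ℂ) • !![-1, 0, 0; 0, 0, -omega ^ 2; 0, -omega, 0] := by
    ext i j
    fin_cases i <;> fin_cases j <;>
      simp [wimanMatrices, WVec.toMat, WVec.toC, WInt.toC, omega_sq, add_comm]
  constructor
  · intro M hM
    obtain ⟨n, hn, rfl⟩ := List.getElem_of_mem hM
    have hn4 : n < 4 := hn
    interval_cases n
    · exact ⟨_, Or.inl rfl, 1, one_ne_zero, h₀⟩
    · exact ⟨_, Or.inr (Or.inl rfl), 1, one_ne_zero, h₁⟩
    · exact ⟨_, Or.inr (Or.inr (Or.inl rfl)), 2, two_ne_zero, h₂⟩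
    · exact ⟨_, Or.inr (Or.inr (Or.inr rfl)), 1, one_ne_zero, h₃⟩
  · rintro A (rfl | rfl | rfl | rfl)
    · exact ⟨_, List.getElem_mem _, 1, one_ne_zero, h₀⟩
    · exact ⟨_, List.getElem_mem _, 1, one_ne_zero, h₁⟩
    · exact ⟨_, List.getElem_mem _, 2, two_ne_zero, h₂⟩
    · exact ⟨_, List.getElem_mem _, 1, one_ne_zero, h₃⟩

lemma exists_mem_valentinerGroup {M : WVec × WVec × WVec} (hM : M ∈ wimanMatrices) :
    ∃ g ∈ valentinerGroup, ∃ c : ℂ, c ≠ 0 ∧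
      WVec.toMat M = c • (g : Matrix (Fin 3) (Fin 3) ℂ) := by
  obtain ⟨A, hA, c, hc, h⟩ := wimanMatrices_spec.1 M hM
  exact ⟨Matrix.GeneralLinearGroup.mkOfDetNeZero A (det_wimanGenerators hA),
    Subgroup.subset_closure hA, c, hc, h⟩

/-! ### The lines of the Wiman arrangement -/

/-- The line with a given index. -/
def lineOf (i : ℕ) : Line := proj (lineVec i).toC

/-- The singular point with a given set of lines. -/
def ptOf (B : List ℕ) : Point := proj (ptVec B).toC

lemma lineVec_toC_ne_zero {i : ℕ} (hi : i < 45) : (lineVec i).toC ≠ 0 := by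
  have h := List.all_eq_true.1 lineVec_ne_zero i (List.mem_range.2 hi)
  rwa [Bool.not_eq_true', ← Bool.not_eq_true, WVec.isZero_iff] at h

lemma ptVec_toC_ne_zero {B : List ℕ} (hB : B ∈ wimanBlocks) : (ptVec B).toC ≠ 0 := by
  have h := List.all_eq_true.1 ptVec_ne_zero B hB
  rwa [Bool.not_eq_true', ← Bool.not_eq_true, WVec.isZero_iff] at h

lemma ptOf_mem_lineOf {B : List ℕ} (hB : B ∈ wimanBlocks) {i : ℕ} (hi : i < 45) :
    ptOf B ∈ lineOf i ↔ i ∈ B := by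
  have h := List.all_eq_true.1 (List.all_eq_true.1 incidence_table B hB) i (List.mem_range.2 hi)
  rw [beq_iff_eq] at h
  rw [ptOf, lineOf, proj_mem_proj (ptVec_toC_ne_zero hB) (lineVec_toC_ne_zero hi),
    ← WVec.toC_dot, ← WInt.isZero_iff, h, List.contains_iff_mem]

lemma exists_block {i j : ℕ} (hi : i < 45) (hj : j < 45) (hij : i ≠ j) :
    ∃ B ∈ wimanBlocks, i ∈ B ∧ j ∈ B := by
  wlog hlt : j < i generalizing i j
  · obtain ⟨B, hB, h1, h2⟩ := this hj hi hij.symm (by omega)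
    exact ⟨B, hB, h2, h1⟩
  have h := List.all_eq_true.1 (List.all_eq_true.1 exists_block_of_pair i (List.mem_range.2 hi)) j
    (List.mem_range.2 hlt)
  obtain ⟨B, hB, h⟩ := List.any_eq_true.1 h
  rw [List.mem_filter] at hB
  exact ⟨B, hB.1, by simpa using hB.2, by simpa using h⟩

lemma lineOf_injOn : Set.InjOn lineOf {i | i < 45} := by
  intro i hi j hj hij
  have h := List.all_eq_true.1 (List.all_eq_true.1 exists_block_separating i
    (List.mem_range.2 hi)) j (List.mem_range.2 hj)
  rw [Bool.or_eq_true, beq_iff_eq] at h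
  rcases h with h | h
  · exact h
  · obtain ⟨B, hB, h⟩ := List.any_eq_true.1 h
    simp only [Bool.and_eq_true, Bool.not_eq_true',
      List.contains_eq_mem, decide_eq_true_eq, decide_eq_false_iff_not] at h
    exact absurd ((ptOf_mem_lineOf hB hj).1 (hij ▸ (ptOf_mem_lineOf hB hi).2 h.1)) h.2

/-- Propagation of `p` along the list; `q` holds side conditions on targets known in advance, such
as index bounds. -/
lemma reaches_forall {α : Type*} {r : α → α → Bool} {p q : α → Prop}
    (hr : ∀ x y, q y → r x y = true → p x → p y) {s xs : List α} (h : reaches r s xs = true)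
    (hq : ∀ y ∈ xs, q y) (hs : ∀ x ∈ s, p x) : ∀ x ∈ xs, p x := by
  induction xs generalizing s with
  | nil => simp
  | cons y ys ih =>
    rw [reaches, Bool.and_eq_true, List.any_eq_true] at h
    obtain ⟨⟨x, hx, hxy⟩, h⟩ := h
    have hy : p y := hr x y (hq y List.mem_cons_self) hxy (hs x hx)
    have hys := ih h (fun z hz => hq z (List.mem_cons_of_mem _ hz)) fun z hz => by
      rcases List.mem_cons.1 hz with rfl | hz
      · exact hy
      · exact hs z hz
    intro z hz
    rcases List.mem_cons.1 hz with rfl | hz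
    · exact hy
    · exact hys z hz

lemma pullback_lineOf {M : WVec × WVec × WVec} {g : GL (Fin 3) ℂ} {c : ℂ} (hc : c ≠ 0)
    (hM : WVec.toMat M = c • (g : Matrix (Fin 3) (Fin 3) ℂ)) {i j : ℕ} (hi : i < 45)
    (hj : j < 45)
    (h : ((WVec.mulVec (WVec.transpose M) (lineVec i)).cross (lineVec j)).isZero = true) :
    pullback g (lineOf i) = lineOf j := by
  rw [lineOf, pullback_proj g (lineVec_toC_ne_zero hi), lineOf, ← proj_smul hc,
    proj_eq_proj (smul_ne_zero hc (vecMul_ne_zero g (lineVec_toC_ne_zero hi)))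
      (lineVec_toC_ne_zero hj)]
  rwa [WVec.isZero_iff, WVec.toC_cross, WVec.toC_mulVec_transpose, hM, Matrix.vecMul_smul] at h

lemma lineOf_zero : lineOf 0 = lineX := by
  have h : (lineVec 0).toC = ![1, 0, 0] := by
    simp [lineVec, wimanLines, WVec.toC, WInt.toC]
  rw [lineOf, h, proj_eq_mk (by simp), lineX]

lemma lineOf_mem_wiman {i : ℕ} (hi : i < 45) : lineOf i ∈ wiman := by
  have h0 : lineOf 0 ∈ wiman := by
    rw [mem_wiman]
    exact ⟨1, one_mem _, by rw [pullback_one, lineOf_zero]⟩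
  have h := reaches_forall (p := fun i => i < 45 ∧ lineOf i ∈ wiman) (q := (· < 45))
    (fun i j hj h ⟨hi, hiw⟩ => by
      obtain ⟨M, hM, h⟩ := List.any_eq_true.1 h
      obtain ⟨g, hg, c, hc, hMg⟩ := exists_mem_valentinerGroup hM
      rw [← pullback_lineOf hc hMg hi hj h, pullback_mem_wiman hg]
      exact ⟨hj, hiw⟩) lines_reached (fun j hj => by
        rw [List.mem_range'_1] at hj
        omega) (by simpa using h0)
  rcases Nat.eq_zero_or_pos i with rfl | hpos
  · exact h0
  · exact (h i (List.mem_range'_1.2 ⟨hpos, by omega⟩)).2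

lemma wiman_eq : wiman = lineOf '' {i | i < 45} := by
  refine Set.Subset.antisymm ?_ ?_
  · set S := lineOf '' {i | i < 45} with hS
    have hfin : S.Finite := (Set.finite_lt_nat 45).image _
    have key : ∀ g ∈ valentinerGroup, ∀ l ∈ S, pullback g l ∈ S := by
      intro g hg
      induction hg using Subgroup.closure_induction with
      | mem g hg =>
        rintro _ ⟨i, hi, rfl⟩
        obtain ⟨M, hM, c, hc, hMg⟩ := wimanMatrices_spec.2 _ hg
        have h := List.all_eq_true.1 (List.all_eq_true.1 lines_closed M hM) i (List.mem_range.2 hi)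
        obtain ⟨j, hj, h⟩ := List.any_eq_true.1 h
        rw [List.mem_range] at hj
        exact ⟨j, hj, (pullback_lineOf hc hMg hi hj h).symm⟩
      | one => exact fun l hl => by rwa [pullback_one]
      | mul g h _ _ hg hh =>
        intro l hl
        rw [pullback_mul]
        exact hh _ (hg l hl)
      -- An injective self-map of a finite set is onto, so closure under `g` gives closure under
      -- `g⁻¹`.
      | inv g _ hg =>
        have hinj : Set.InjOn (pullback g) S := fun l _ m _ h => by
          have := congrArg (pullback g⁻¹) h
          rwa [← pullback_mul, ← pullback_mul, mul_inv_cancel, pullback_one, pullback_one] at this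
        intro l hl
        have himg : pullback g '' S = S :=
          Set.eq_of_subset_of_ncard_le (Set.image_subset_iff.2 hg)
            hinj.ncard_image.ge hfin
        obtain ⟨m, hm, rfl⟩ := himg.symm ▸ hl
        rwa [← pullback_mul, mul_inv_cancel, pullback_one]
    intro l hl
    obtain ⟨g, hg, rfl⟩ := mem_wiman.1 hl
    rw [← lineOf_zero]
    exact key g hg _ ⟨0, by simp, rfl⟩
  · rintro _ ⟨i, hi, rfl⟩
    exact lineOf_mem_wiman hi

lemma ncard_image_list {α β : Type*} {f : α → β} {l : List α} (hl : l.Nodup)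
    (hf : Set.InjOn f {x | x ∈ l}) : (f '' {x | x ∈ l}).ncard = l.length := by
  classical
  rw [hf.ncard_image, ← List.toFinset_card_of_nodup hl, ← Set.ncard_coe_finset]
  congr 1
  ext x
  simp

lemma wiman_finite : wiman.Finite := wiman_eq ▸ (Set.finite_lt_nat 45).image _

lemma wiman_ncard : wiman.ncard = 45 := by
  have h : {i | i < 45} = {i | i ∈ List.range 45} := by
    ext
    simp
  rw [wiman_eq, h, ncard_image_list List.nodup_range (h ▸ lineOf_injOn), List.length_range]

/-! ### The singular points of the Wiman arrangement -/

lemma lt_of_mem_block {B : List ℕ} (hB : B ∈ wimanBlocks) {i : ℕ} (hi : i ∈ B) : i < 45 := by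
  have h := List.all_eq_true.1 blocks_sorted B hB
  rw [Bool.and_eq_true, List.all_eq_true] at h
  simpa using h.1 i hi

lemma block_pairwise {B : List ℕ} (hB : B ∈ wimanBlocks) : B.Pairwise (· < ·) := by
  have h := List.all_eq_true.1 blocks_sorted B hB
  rw [Bool.and_eq_true, decide_eq_true_eq] at h
  exact h.2

lemma block_nodup {B : List ℕ} (hB : B ∈ wimanBlocks) : B.Nodup :=
  (block_pairwise hB).imp fun h => h.ne

lemma ptOf_injOn : Set.InjOn ptOf {B | B ∈ wimanBlocks} := by
  intro B hB B' hB' h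
  have hmem : ∀ i, i ∈ B ↔ i ∈ B' := fun i => by
    constructor
    · intro hi
      have hi' := lt_of_mem_block hB hi
      rwa [← ptOf_mem_lineOf hB' hi', ← h, ptOf_mem_lineOf hB hi']
    · intro hi
      have hi' := lt_of_mem_block hB' hi
      rwa [← ptOf_mem_lineOf hB hi', h, ptOf_mem_lineOf hB' hi']
  exact ((List.perm_ext_iff_of_nodup (block_nodup hB) (block_nodup hB')).2 hmem).eq_of_pairwise
    (fun a b _ _ h₁ h₂ => absurd h₁ h₂.asymm) (block_pairwise hB) (block_pairwise hB')

lemma mult_ptOf {B : List ℕ} (hB : B ∈ wimanBlocks) : mult wiman (ptOf B) = B.length := by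
  have h : {l ∈ wiman | ptOf B ∈ l} = lineOf '' {i | i ∈ B} := by
    rw [wiman_eq]
    ext l
    constructor
    · rintro ⟨⟨i, hi, rfl⟩, h⟩
      exact ⟨i, (ptOf_mem_lineOf hB hi).1 h, rfl⟩
    · rintro ⟨i, hi, rfl⟩
      have hi' := lt_of_mem_block hB hi
      exact ⟨⟨i, hi', rfl⟩, (ptOf_mem_lineOf hB hi').2 hi⟩
  rw [mult, h, ncard_image_list (block_nodup hB)
    (lineOf_injOn.mono fun i hi => lt_of_mem_block hB hi)]

lemma sing_wiman : Sing wiman = ptOf '' {B | B ∈ wimanBlocks} := by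
  ext P
  constructor
  · rintro ⟨l, hl, m, hm, hlm, hPl, hPm⟩
    rw [wiman_eq] at hl hm
    obtain ⟨i, hi, rfl⟩ := hl
    obtain ⟨j, hj, rfl⟩ := hm
    obtain ⟨B, hB, hiB, hjB⟩ := exists_block hi hj fun e => hlm (by rw [e])
    exact ⟨B, hB, ((eq_or_eq_of_mem hPl ((ptOf_mem_lineOf hB hi).2 hiB) hPm
      ((ptOf_mem_lineOf hB hj).2 hjB)).resolve_right hlm).symm⟩
  · rintro ⟨B, hB, rfl⟩
    have h2 : 1 < mult wiman (ptOf B) := by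
      rw [mult_ptOf hB]
      exact of_decide_eq_true (List.all_eq_true.1 blocks_length.1 B hB)
    obtain ⟨l, m, hl, hm, hlm⟩ :=
      (Set.one_lt_ncard_iff (wiman_finite.subset fun _ h => h.1)).1 h2
    exact ⟨l, hl.1, m, hm.1, hlm, hl.2, hm.2⟩

lemma exists_block_of_mult {P : Point} (h : 2 ≤ mult wiman P) : ∃ B ∈ wimanBlocks, P = ptOf B := by
  obtain ⟨l, m, hl, hm, hlm⟩ :=
    (Set.one_lt_ncard_iff (wiman_finite.subset fun _ h => h.1)).1 h
  have hP : P ∈ Sing wiman := ⟨l, hl.1, m, hm.1, hlm, hl.2, hm.2⟩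
  rw [sing_wiman] at hP
  obtain ⟨B, hB, e⟩ := hP
  exact ⟨B, hB, e.symm⟩

/-- The bound on `r` restricts to singular points, the only ones in the table. -/
lemma t_wiman {r : ℕ} (hr : 2 ≤ r) :
    t wiman r = (wimanBlocks.filter (·.length == r)).length := by
  have h : {P | mult wiman P = r} = ptOf '' {B | B ∈ wimanBlocks.filter (·.length == r)} := by
    ext P
    constructor
    · intro hP
      have hP' : mult wiman P = r := hP
      obtain ⟨B, hB, rfl⟩ := exists_block_of_mult (hP'.symm ▸ hr)
      rw [mult_ptOf hB] at hP'
      exact ⟨B, List.mem_filter.2 ⟨hB, by simpa using hP'⟩, rfl⟩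
    · rintro ⟨B, hB, rfl⟩
      obtain ⟨hB, h⟩ := List.mem_filter.1 hB
      exact (mult_ptOf hB).trans (by simpa using h)
  rw [t, h, ncard_image_list (blocks_nodup.filter _)
    (ptOf_injOn.mono fun B hB => (List.mem_filter.1 hB).1)]

/-! ### The joins at a quintuple point -/

lemma quintBlocks_eq : quintBlocks = quint₀ :: quintBlocks.tail := by
  decide +kernel

lemma quint₀_spec : quint₀ ∈ wimanBlocks ∧ quint₀ ≠ [] := by
  decide +kernel

lemma remaining_quint₀ : remaining wiman (ptOf quint₀) = ptOf '' {B | B ∈ remBlocks} := by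
  ext P
  rw [remaining, sing_wiman]
  constructor
  · rintro ⟨⟨B, hB, rfl⟩, h⟩
    refine ⟨B, List.mem_filter.2 ⟨hB, ?_⟩, rfl⟩
    rw [List.all_eq_true]
    intro i hi
    have hi' := lt_of_mem_block hB hi
    simp only [Bool.not_eq_true', List.contains_eq_mem, decide_eq_false_iff_not]
    intro hi0
    exact h _ (lineOf_mem_wiman hi') ((ptOf_mem_lineOf quint₀_spec.1 hi').2 hi0)
      ((ptOf_mem_lineOf hB hi').2 hi)
  · rintro ⟨B, hB, rfl⟩
    obtain ⟨hB, h⟩ := List.mem_filter.1 hB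
    refine ⟨⟨B, hB, rfl⟩, fun l hl hOl hPl => ?_⟩
    rw [wiman_eq] at hl
    obtain ⟨i, hi, rfl⟩ := hl
    have h1 := List.all_eq_true.1 h i ((ptOf_mem_lineOf hB hi).1 hPl)
    simp only [Bool.not_eq_true', List.contains_eq_mem, decide_eq_false_iff_not] at h1
    exact h1 ((ptOf_mem_lineOf quint₀_spec.1 hi).1 hOl)

/-- The line joining `quint₀` to a singular point. -/
def joinOf (B : List ℕ) : Line := proj ((ptVec quint₀).cross (ptVec B)).toC

lemma ptOf_ne_quint₀ {B : List ℕ} (hB : B ∈ remBlocks) : ptOf quint₀ ≠ ptOf B := by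
  obtain ⟨hB, h⟩ := List.mem_filter.1 hB
  intro e
  obtain rfl := ptOf_injOn quint₀_spec.1 hB e
  obtain ⟨i, hi⟩ := List.exists_mem_of_ne_nil _ quint₀_spec.2
  have h1 := List.all_eq_true.1 h i hi
  simp only [Bool.not_eq_true', List.contains_eq_mem, decide_eq_false_iff_not] at h1
  exact h1 hi

lemma joinVec_ne_zero {B : List ℕ} (hB : B ∈ remBlocks) :
    ((ptVec quint₀).cross (ptVec B)).toC ≠ 0 := by
  rw [WVec.toC_cross, Ne, ← proj_eq_proj (ptVec_toC_ne_zero quint₀_spec.1)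
    (ptVec_toC_ne_zero (List.mem_filter.1 hB).1)]
  exact ptOf_ne_quint₀ hB

lemma quint₀_mem_joinOf {B : List ℕ} (hB : B ∈ remBlocks) : ptOf quint₀ ∈ joinOf B := by
  rw [joinOf, ptOf, proj_mem_proj (ptVec_toC_ne_zero quint₀_spec.1) (joinVec_ne_zero hB),
    WVec.toC_cross, dotProduct_comm, dot_self_cross]

lemma ptOf_mem_joinOf {B : List ℕ} (hB : B ∈ remBlocks) : ptOf B ∈ joinOf B := by
  rw [joinOf, ptOf, proj_mem_proj (ptVec_toC_ne_zero (List.mem_filter.1 hB).1)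
    (joinVec_ne_zero hB), WVec.toC_cross, dotProduct_comm, dot_cross_self]

lemma ptOf_mem_joinOf_iff {B B' : List ℕ} (hB : B ∈ remBlocks) (hB' : B' ∈ remBlocks) :
    ptOf B' ∈ joinOf B ↔ ¬ JoinNe B B' := by
  rw [JoinNe, Bool.not_eq_false, joinOf, ptOf,
    proj_mem_proj (ptVec_toC_ne_zero (List.mem_filter.1 hB').1) (joinVec_ne_zero hB), ← WVec.toC_dot, WInt.isZero_iff]

lemma joinOf_eq {B : List ℕ} (hB : B ∈ remBlocks) {l : Line} (hO : ptOf quint₀ ∈ l)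
    (hl : ptOf B ∈ l) : joinOf B = l :=
  (eq_or_eq_of_mem (quint₀_mem_joinOf hB) (ptOf_mem_joinOf hB) hO hl).resolve_left
    (ptOf_ne_quint₀ hB)

/-- Maximality of the greedy selection: an element is discarded only because it conflicts with a
kept one. For `JoinNe` this means that every join has a kept representative. -/
lemma mem_pwFilter_or {α : Type*} {R : α → α → Prop} [DecidableRel R] {l : List α} :
    ∀ a ∈ l, a ∈ l.pwFilter R ∨ ∃ b ∈ l.pwFilter R, ¬ R a b := by
  induction l with
  | nil => simp
  | cons x l ih =>
    by_cases h : ∀ b ∈ l.pwFilter R, R x b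
    · rw [List.pwFilter_cons_of_pos h]
      rintro a ha
      rcases List.mem_cons.1 ha with rfl | ha
      · exact Or.inl List.mem_cons_self
      · rcases ih a ha with h' | ⟨b, hb, h'⟩
        · exact Or.inl (List.mem_cons_of_mem _ h')
        · exact Or.inr ⟨b, List.mem_cons_of_mem _ hb, h'⟩
    · rw [List.pwFilter_cons_of_neg h]
      rintro a ha
      rcases List.mem_cons.1 ha with rfl | ha
      · push Not at h
        exact Or.inr h
      · exact ih a ha

lemma joinBlocks_subset {B : List ℕ} (hB : B ∈ joinBlocks) : B ∈ remBlocks := by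
  rw [joinBlocks] at hB
  exact List.Sublist.mem hB (List.pwFilter_sublist (R := JoinNe) remBlocks)

lemma joins_quint₀ : joins wiman (ptOf quint₀) = joinOf '' {B | B ∈ joinBlocks} := by
  ext l
  rw [joins, remaining_quint₀]
  constructor
  · rintro ⟨hO, _, ⟨B, hB, rfl⟩, hl⟩
    rcases mem_pwFilter_or (R := JoinNe) B hB with h | ⟨B', hB', h⟩
    · exact ⟨B, h, joinOf_eq hB hO hl⟩
    · have hB'r := joinBlocks_subset hB'
      rw [← ptOf_mem_joinOf_iff hB hB'r, joinOf_eq hB hO hl] at h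
      exact ⟨B', hB', joinOf_eq hB'r hO h⟩
  · rintro ⟨B, hB, rfl⟩
    rw [Set.mem_ofPred_eq] at hB
    have hBr := joinBlocks_subset hB
    exact ⟨quint₀_mem_joinOf hBr, ptOf B, ⟨B, hBr, rfl⟩, ptOf_mem_joinOf hBr⟩

lemma remBlocks_nodup : remBlocks.Nodup := blocks_nodup.filter _

lemma joinOf_injOn : Set.InjOn joinOf {B | B ∈ joinBlocks} := by
  intro B hB B' hB' h
  rw [Set.mem_ofPred_eq] at hB hB'
  by_contra hne
  have hR : ∀ C ∈ joinBlocks, ∀ D ∈ joinBlocks, joinOf C = joinOf D →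
      ¬ JoinNe C D := by
    intro C hC D hD e
    rw [← ptOf_mem_joinOf_iff (joinBlocks_subset hC) (joinBlocks_subset hD), e]
    exact ptOf_mem_joinOf (joinBlocks_subset hD)
  have hN : joinBlocks.Pairwise JoinNe := by
    rw [joinBlocks]
    exact List.pairwise_pwFilter (R := JoinNe) remBlocks
  have hp : joinBlocks.Pairwise fun C D => joinOf C ≠ joinOf D :=
    hN.imp_of_mem fun hC hD hCD e => hR _ hC _ hD e hCD
  have : Std.Symm fun C D => joinOf C ≠ joinOf D := ⟨fun _ _ h => h.symm⟩
  exact hp.forall hB hB' hne h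

/-- The numbers of remaining points and of joins are those of the Wiman arrangement at its
quintuple points. -/
def HasWimanJoins (O : Point) : Prop :=
  (remaining wiman O).ncard = 125 ∧ (joins wiman O).ncard = 85

lemma hasWimanJoins_quint₀ : HasWimanJoins (ptOf quint₀) := by
  constructor
  · rw [remaining_quint₀, ncard_image_list remBlocks_nodup
      (ptOf_injOn.mono fun B hB => (List.mem_filter.1 hB).1), remBlocks_length]
  · rw [joins_quint₀, ncard_image_list (l := joinBlocks)
      (remBlocks_nodup.sublist (List.pwFilter_sublist (R := JoinNe) _)) joinOf_injOn,
      joinBlocks_length]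

/-- Points move by `g` and lines by pullback along `g⁻¹`. This preserves incidence and the
arrangement, hence everything defined from them. -/
lemma HasWimanJoins.smul {g : GL (Fin 3) ℂ} (hg : g ∈ valentinerGroup) {O : Point}
    (hO : HasWimanJoins O) : HasWimanJoins (g • O) := by
  set ψ : Line → Line := pullback g⁻¹ with hψ
  have hψψ : ∀ l, pullback g (ψ l) = l := fun l => by
    rw [hψ, ← pullback_mul, inv_mul_cancel, pullback_one]
  have hψψ' : ∀ l, ψ (pullback g l) = l := fun l => by
    rw [hψ, ← pullback_mul, mul_inv_cancel, pullback_one]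
  have hinj : Function.Injective ψ := fun l m h => by rw [← hψψ l, h, hψψ]
  have hmem : ∀ {P : Point} {l : Line}, g • P ∈ ψ l ↔ P ∈ l := fun {P l} => by
    rw [← mem_pullback, hψψ]
  have hw : ∀ {l}, ψ l ∈ wiman ↔ l ∈ wiman := pullback_mem_wiman (inv_mem hg)
  have hrem : ∀ {P : Point}, g • P ∈ remaining wiman (g • O) ↔ P ∈ remaining wiman O := by
    intro P
    constructor
    · rintro ⟨⟨l, hl, m, hm, hlm, hPl, hPm⟩, h⟩
      refine ⟨⟨pullback g l, (pullback_mem_wiman hg).2 hl, pullback g m,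
        (pullback_mem_wiman hg).2 hm, fun e => hlm (by rw [← hψψ' l, e, hψψ']),
        mem_pullback.2 hPl, mem_pullback.2 hPm⟩, fun l hl hOl hPl => ?_⟩
      exact h (ψ l) (hw.2 hl) (hmem.2 hOl) (hmem.2 hPl)
    · rintro ⟨⟨l, hl, m, hm, hlm, hPl, hPm⟩, h⟩
      refine ⟨⟨ψ l, hw.2 hl, ψ m, hw.2 hm, hinj.ne hlm, hmem.2 hPl, hmem.2 hPm⟩,
        fun l hl hOl hPl => ?_⟩
      exact h (pullback g l) ((pullback_mem_wiman hg).2 hl) (mem_pullback.2 hOl)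
        (mem_pullback.2 hPl)
  have h1 : remaining wiman (g • O) = (g • ·) '' remaining wiman O := by
    ext P
    constructor
    · intro h
      refine ⟨g⁻¹ • P, hrem.1 ?_, smul_inv_smul g P⟩
      rwa [smul_inv_smul]
    · rintro ⟨P, hP, rfl⟩
      exact hrem.2 hP
  have h2 : joins wiman (g • O) = ψ '' joins wiman O := by
    ext l
    constructor
    · rintro ⟨hO, P, hP, hPl⟩
      refine ⟨pullback g l, ⟨mem_pullback.2 hO, g⁻¹ • P, hrem.1 ?_, mem_pullback.2 ?_⟩, hψψ' l⟩
      · rwa [smul_inv_smul]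
      · rwa [smul_inv_smul]
    · rintro ⟨l, ⟨hO, P, hP, hPl⟩, rfl⟩
      exact ⟨hmem.2 hO, g • P, hrem.2 hP, hmem.2 hPl⟩
  exact ⟨by rw [h1, Set.ncard_image_of_injective _ (MulAction.injective g), hO.1],
    by rw [h2, Set.ncard_image_of_injective _ hinj, hO.2]⟩

lemma hasWimanJoins_of_mult {O : Point} (hO : mult wiman O = 5) : HasWimanJoins O := by
  obtain ⟨B, hB, rfl⟩ := exists_block_of_mult (by omega : 2 ≤ mult wiman O)
  rw [mult_ptOf hB] at hO
  have hsub : ∀ {B}, B ∈ quintBlocks → B ∈ wimanBlocks := fun h => (List.mem_filter.1 h).1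
  have hBq : B ∈ quint₀ :: quintBlocks.tail :=
    quintBlocks_eq ▸ List.mem_filter.2 ⟨hB, by simpa using hO⟩
  have h := reaches_forall (p := fun B => B ∈ wimanBlocks ∧ HasWimanJoins (ptOf B))
    (q := (· ∈ wimanBlocks)) (fun B B' hB' h ⟨hB, hBj⟩ => by
      obtain ⟨M, hM, h⟩ := List.any_eq_true.1 h
      obtain ⟨g, hg, c, hc, hMg⟩ := exists_mem_valentinerGroup hM
      have hv : (g : Matrix (Fin 3) (Fin 3) ℂ) *ᵥ (ptVec B).toC ≠ 0 :=
        (smul_ne_zero_iff_ne g).2 (ptVec_toC_ne_zero hB)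
      have e : g • ptOf B = ptOf B' := by
        rw [ptOf, smul_proj g (ptVec_toC_ne_zero hB), ptOf, ← proj_smul hc,
          proj_eq_proj (smul_ne_zero hc hv) (ptVec_toC_ne_zero hB')]
        rwa [WVec.isZero_iff, WVec.toC_cross, WVec.toC_mulVec, hMg, Matrix.smul_mulVec] at h
      exact ⟨hB', e ▸ hBj.smul hg⟩) quint_reached
    (fun B hB => hsub (List.mem_of_mem_tail hB))
    (by simpa using ⟨quint₀_spec.1, hasWimanJoins_quint₀⟩)
  rcases List.mem_cons.1 hBq with rfl | hBq
  · exact hasWimanJoins_quint₀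
  · exact (h B hBq).2

/-! ### The resolution of length 125 and the final assembly. -/

lemma exists_wiman_resolution {O : Point} (hO : mult wiman O = 5) :
    ∃ Y : Fin (125 + 1) → Set Line,
      IsSupersolvableResolution wiman 125 Y ∧
      joins wiman O ⊆ Y (Fin.last 125) ∧
      (∀ l ∈ Y (Fin.last 125), l ∉ wiman → O ∈ l) ∧
      (Y (Fin.last 125)).ncard = 170 ∧
      IsFreeWithExponents (Y (Fin.last 125)) 40 129 := by
  have hJ := (hasWimanJoins_of_mult hO).2
  -- An infinite set has `ncard` zero, so the count 85 already gives finiteness.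
  have hJf : (joins wiman O).Finite := Set.finite_of_ncard_pos (by omega)
  have hlt : mult wiman O < wiman.ncard := by rw [hO, wiman_ncard]; norm_num
  obtain ⟨-, -, l₁, -, l₂, -, h₁₂, -, hO₁, hO₂⟩ :=
    exists_lines_of_mult wiman_finite (by omega : 2 ≤ mult wiman O) hlt
  -- The `125 - 85 = 40` padding lines: any new lines through `O` will do.
  obtain ⟨E, hE, hEf, hE40⟩ := Set.Infinite.exists_subset_ncard_eq
    ((infinite_pencil O h₁₂ hO₁ hO₂).sdiff (wiman_finite.union hJf)) 40
  set K := joins wiman O ∪ E with hK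
  have hKf : K.Finite := hJf.union hEf
  have hJK : joins wiman O ⊆ K := Set.subset_union_left
  have hKO : ∀ l ∈ K, O ∈ l := by
    rintro l (h | h)
    · exact h.1
    · exact (hE h).1
  have hd : Disjoint wiman K := Set.disjoint_union_right.2 ⟨disjoint_joins _ _,
    Set.disjoint_left.2 fun l hl hlE => (hE hlE).2 (Or.inl hl)⟩
  have hK125 : K.ncard = 125 := by
    rw [ncard_union_of_disjoint hJf hEf
      (Set.disjoint_left.2 fun l hl hlE => (hE hlE).2 (Or.inr hl)), hJ, hE40]
  obtain ⟨Y, hY, hlast⟩ := exists_isSupersolvableResolution wiman_finite hKf hd hK125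
    (isSupersolvable_union wiman_finite (by omega) hlt hJK hKO)
  refine ⟨Y, hY, ?_, ?_, ?_, ?_⟩ <;> rw [hlast]
  · exact hJK.trans Set.subset_union_right
  · exact fun l hl hlw => hKO l (hl.resolve_left hlw)
  · rw [ncard_union_of_disjoint wiman_finite hKf hd, wiman_ncard, hK125]
  · have h := isFreeWithExponents_union wiman_finite hKf hd (by omega) hlt hJK hKO
    rwa [hO, wiman_ncard, hK125] at h

end LineArr

end

theorem mainTheorem3 :
    LineArr.wiman.ncard = 45 ∧
    LineArr.t LineArr.wiman 3 = 120 ∧ LineArr.t LineArr.wiman 4 = 45 ∧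
    LineArr.t LineArr.wiman 5 = 36 ∧
    LineArr.extSS LineArr.wiman ≤ 125 ∧
    ∀ O : LineArr.Point, LineArr.mult LineArr.wiman O = 5 →
      (LineArr.remaining LineArr.wiman O).ncard = 125 ∧
      (LineArr.joins LineArr.wiman O).ncard = 85 ∧
      (LineArr.wiman ∪ LineArr.joins LineArr.wiman O).ncard = 130 ∧
      LineArr.IsSupersolvable (LineArr.wiman ∪ LineArr.joins LineArr.wiman O) ∧
      LineArr.IsFreeWithExponents (LineArr.wiman ∪ LineArr.joins LineArr.wiman O) 40 89 ∧
      ∃ Y : Fin (125 + 1) → Set LineArr.Line,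
        LineArr.IsSupersolvableResolution LineArr.wiman 125 Y ∧
        LineArr.joins LineArr.wiman O ⊆ Y (Fin.last 125) ∧
        (∀ l ∈ Y (Fin.last 125), l ∉ LineArr.wiman → O ∈ l) ∧
        (Y (Fin.last 125)).ncard = 170 ∧
        LineArr.IsFreeWithExponents (Y (Fin.last 125)) 40 129 := by
  open LineArr in
  have hquint : mult wiman (ptOf quint₀) = 5 := by
    have h : quint₀ ∈ quintBlocks := quintBlocks_eq ▸ List.mem_cons_self
    rw [mult_ptOf quint₀_spec.1]
    simpa using (List.mem_filter.1 h).2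
  refine ⟨wiman_ncard, ?_, ?_, ?_, ?_, fun O hO => ?_⟩
  · rw [t_wiman (by norm_num), blocks_length.2.1]
  · rw [t_wiman (by norm_num), blocks_length.2.2.1]
  · rw [t_wiman (by norm_num), blocks_length.2.2.2]
  · obtain ⟨Y, hY, -⟩ := exists_wiman_resolution hquint
    exact iInf₂_le_of_le 125 ⟨Y, hY⟩ le_rfl
  · obtain ⟨h125, h85⟩ := hasWimanJoins_of_mult hO
    have hJf : (joins wiman O).Finite := Set.finite_of_ncard_pos (by omega)
    have hlt : mult wiman O < wiman.ncard := by rw [hO, wiman_ncard]; norm_num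
    have hd := disjoint_joins wiman O
    have hJO : ∀ l ∈ joins wiman O, O ∈ l := fun l hl => hl.1
    refine ⟨h125, h85, ?_, ?_, ?_, exists_wiman_resolution hO⟩
    · rw [ncard_union_of_disjoint wiman_finite hJf hd, wiman_ncard, h85]
    · exact isSupersolvable_union wiman_finite (by omega) hlt subset_rfl hJO
    · have h := isFreeWithExponents_union wiman_finite hJf hd (by omega) hlt subset_rfl hJO
      rwa [hO, wiman_ncard, h85] at h
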